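/- Let $\alpha(G)$ denote the independence number and $\delta(G)$ the minimum degree of a finite graph $G$. An $F$-tiling in $G$ is a collection of pairwise vertex-disjoint (not necessarily induced) copies of $F$ in $G$. For a $k$-vertex graph $F$ and $\eta>0$, an $F$-tiling in $G$ is called $\eta$-quasiperfect if it covers all but at most $\lfloor 1/\eta\rfloor (k-1)$ vertices of $G$. For $r\ge 1$, $\alpha_r(G)$ is the largest size of a set of vertices of $G$ containing no clique on $r$ vertices (so $\alpha_2(G)=\alpha(G)$), and, for a $k$-vertex graph $F$ with $r\le k$, $\mathbf{RTT}_r(F)$ is the largest $\eta_0\ge 0$ such that for all $0<\eta<\eta_0$ and all $\alpha>0$, for all sufficiently large $n$ there exists an $n$-vertex graph $G$ with $\delta(G)\ge \eta n$ and $\alpha_r(G)\le \alpha n$ that contains no $\eta$-quasiperfect $F$-tiling. Theorem. Let $k\ge 3$ be an integer. (a) For every real $0<\eta\le 1$ there exists $\alpha>0$ such that for all sufficiently large $n\in\mathbb{N}$, every $n$-vertex graph $G$ with $\delta(G)\ge \eta n$ and $\alpha(G)\le \alpha n$ contains an $\eta$-quasiperfect $T_k$-tiling for every $k$-vertex tree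 $T_k$. (b) Consequently, $\mathbf{RTT}_2(T_k)=0$ for every $k$-vertex tree $T_k$. -/

import Mathlib

open Filter

namespace SimpleGraph

/-- The `r`-independence number `α_r(G)` of a finite graph: the largest size of a set of vertices
that contains no clique on `r` vertices (so `α_2` is the usual independence number). -/
noncomputable def cliqueFreeNum {V : Type*} (G : SimpleGraph V) (r : ℕ) : ℕ :=
  sSup {m | ∃ s : Finset V, s.card = m ∧ G.CliqueFreeOn (s : Set V) r}

/-- An `F`-tiling in `G`: a collection of pairwise vertex-disjoint (not necessarily induced)
copies of `F` in `G`. -/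
def IsTiling {W V : Type*} (F : SimpleGraph W) (G : SimpleGraph V) (M : Set (Copy F G)) : Prop :=
  M.PairwiseDisjoint fun f => Set.range (f : W → V)

/-- The set of vertices of `G` that lie in no copy of the collection `M`. -/
def uncovered {W V : Type*} {F : SimpleGraph W} {G : SimpleGraph V} (M : Set (Copy F G)) : Set V :=
  {v | ∀ f ∈ M, v ∉ Set.range (f : W → V)}

/-- An `F`-tiling `M` in `G`, where `F` has `k` vertices, is `η`-quasiperfect if it covers all but
at most `⌊1/η⌋ (k - 1)` vertices of `G`. -/
def IsQuasiperfectTiling {W V : Type*} [Fintype W] (F : SimpleGraph W) (G : SimpleGraph V)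
    (η : ℝ) (M : Set (Copy F G)) : Prop :=
  F.IsTiling G M ∧ (uncovered M).ncard ≤ ⌊1 / η⌋₊ * (Fintype.card W - 1)

open Classical in
/-- The numbers `η₀ ≥ 0` such that for all `0 < η < η₀` and `α > 0` and all sufficiently large `n`,
some `n`-vertex graph `G` with `δ(G) ≥ η n` and `α_r(G) ≤ α n` has no `η`-quasiperfect
`F`-tiling. -/
def rttSet {W : Type*} [Fintype W] (r : ℕ) (F : SimpleGraph W) : Set ℝ :=
  {η₀ | 0 ≤ η₀ ∧ ∀ η : ℝ, 0 < η → η < η₀ → ∀ α : ℝ, 0 < α → ∀ᶠ n : ℕ in atTop,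
    ∃ G : SimpleGraph (Fin n), η * n ≤ G.minDegree ∧ (G.cliqueFreeNum r : ℝ) ≤ α * n ∧
      ¬ ∃ M : Set (Copy F G), F.IsQuasiperfectTiling G η M}

/-- The Ramsey–Turán tiling threshold `RTT_r(F)`: the largest element of `rttSet r F`
(which exists, see `isGreatest_RTT`). -/
noncomputable def RTT {W : Type*} [Fintype W] (r : ℕ) (F : SimpleGraph W) : ℝ :=
  sSup (rttSet r F)

theorem isGreatest_RTT {W : Type*} [Fintype W] (r : ℕ) (F : SimpleGraph W) :
    IsGreatest (rttSet r F) (RTT r F) := by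
  classical
  have hne : (0 : ℝ) ∈ rttSet r F := ⟨le_rfl, fun η h h' => absurd h' (not_lt.2 h.le)⟩
  have hb : BddAbove (rttSet r F) := by
    refine ⟨1, fun η₀ h => ?_⟩
    by_contra! hlt
    obtain ⟨n, ⟨G, hG, -, -⟩, hn⟩ := ((h.2 ((1 + η₀) / 2) (by linarith) (by linarith) 1 one_pos).and
      (eventually_ge_atTop 1)).exists
    have : Nonempty (Fin n) := ⟨⟨0, hn⟩⟩
    have h1 : (G.minDegree : ℝ) < n := by
      exact_mod_cast (G.minDegree_lt_card).trans_eq (Fintype.card_fin n)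
    have h2 : (1 : ℝ) ≤ n := by exact_mod_cast hn
    have h3 : (n : ℝ) ≤ (1 + η₀) / 2 * n := le_mul_of_one_le_left (by linarith) (by linarith)
    exact absurd (h3.trans hG) (not_le.2 h1)
  refine ⟨⟨le_csSup hb hne, fun η h0 h1 α hα => ?_⟩, fun x hx => le_csSup hb hx⟩
  obtain ⟨x, hx, hlt⟩ := exists_lt_of_lt_csSup ⟨0, hne⟩ h1
  exact hx.2 η h0 hlt α hα

end SimpleGraph

/-! The proof is by absorption. Small independence number makes every set of more than `k *
indepNum` vertices contain each tree on `k` vertices (`IsTree.exists_copy_of_indepNum_lt`), since a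
graph without a subgraph of large minimum degree has a large independent set. A maximal tiling
therefore leaves few vertices over, and the task is to absorb them.

Applied inside the neighbourhood of `x`, the same fact gives a core: `k - 1` vertices, `x` among
them, which any further neighbour of `x` completes to a copy of the tree (`IsTree.exists_isCore`). A
helper is a core at `x` together with one completing neighbour `y`. If a leftover vertex `u` is
adjacent to `x`, it can replace `y`, so the hole moves from `u` to `y` along the walk `u, x, y`.
Holes thus travel along double steps. When `k` holes arrive at the completing vertices of `k`
helpers, chosen so that these vertices themselves span a copy of the tree, all `k` holes are filled
at once (`IsHelperSystem.absorb_group`).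

This needs `k` leftover vertices that can reach common targets. `exists_clusters` splits the
vertices into at most `⌊1 / η⌋` classes, each with linearly many targets `z` whose neighbourhoods
are reached robustly from the whole class. The bound on the number of classes comes from degrees:
more than `1 / η` neighbourhoods of size `η n` cannot be almost disjoint. As long as more than `⌊1 /
η⌋ (k - 1)` vertices remain, some class contains `k` of them.

The helpers must be available for every step that may be required. There are only polynomially many
such events, each consisting of quadratically many pairs `(x, y)`, and a derandomised greedy choice
(`IsTree.exists_helperSystem`) hits each of them linearly often with disjoint helpers. -/

namespace SimpleGraph

/-! ### Embedding trees, tileable sets and cores. -/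

section TreeTiling

open scoped Classical

/-- The neighbourhood of a vertex of a finite graph, as a finset. -/
noncomputable def nbr {V : Type*} [Fintype V] (G : SimpleGraph V) (v : V) : Finset V :=
  Finset.univ.filter (G.Adj v)

@[simp] theorem mem_nbr {V : Type*} [Fintype V] {G : SimpleGraph V} {v w : V} :
    w ∈ G.nbr v ↔ G.Adj v w := by simp [nbr]

theorem IsTree.exists_leaf {W : Type*} [Fintype W] [Nontrivial W] {T : SimpleGraph W}
    (hT : T.IsTree) : ∃ l p : W, T.Adj l p ∧ (∀ w, T.Adj l w → w = p) ∧
      (T.induce {l}ᶜ).IsTree := by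
  obtain ⟨l, hl⟩ := hT.exists_vert_degree_one_of_nontrivial
  obtain ⟨p, hp, hu⟩ := degree_eq_one_iff_existsUnique_adj.mp hl
  exact ⟨l, p, hp, hu, hT.1.induce_compl_singleton_of_degree_eq_one hl, hT.2.induce _⟩

/-- A tree on at most `d` vertices embeds into every graph of minimum degree at least `d`. -/
theorem IsTree.exists_copy_of_le_degree {V : Type*} [Fintype V] {G : SimpleGraph V}
    {S : Finset V} (hS : S.Nonempty) (k : ℕ) :
    ∀ {W : Type*} [Fintype W] {T : SimpleGraph W}, T.IsTree → Fintype.card W = k →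
      (∀ v ∈ S, k ≤ (G.nbr v ∩ S).card) → ∃ f : Copy T G, ∀ w, f w ∈ S := by
  induction k with
  | zero =>
    intro W _ T hT hk
    have := hT.1.nonempty
    exact absurd hk Fintype.card_ne_zero
  | succ k ih =>
    intro W _ T hT hk hd
    rcases subsingleton_or_nontrivial W with h | h
    · obtain ⟨s, hs⟩ := hS
      refine ⟨⟨⟨fun _ => s, fun {a b} hab => ?_⟩, fun a b _ => Subsingleton.elim a b⟩, fun _ => hs⟩
      exact absurd (Subsingleton.elim a b) hab.ne
    · obtain ⟨l, p, hlp, hu, hT'⟩ := hT.exists_leaf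
      have hc : Fintype.card ({l}ᶜ : Set W) = k := by
        rw [Fintype.card_compl_set, hk]; simp
      obtain ⟨f, hf⟩ := ih hT' hc (fun v hv => (Nat.le_succ k).trans (hd v hv))
      have hpl : p ∈ ({l}ᶜ : Set W) := by simpa using hlp.ne'
      -- The tree without its leaf occupies only `k` vertices, so the image of `p` has an unused
      -- neighbour for the leaf.
      have : ((Finset.univ.image f : Finset V)).card < (G.nbr (f ⟨p, hpl⟩) ∩ S).card := by
        refine lt_of_le_of_lt Finset.card_image_le ?_
        rw [Finset.card_univ, hc]
        exact hd _ (hf _)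
      obtain ⟨z, hz, hzf⟩ := Finset.exists_mem_notMem_of_card_lt_card this
      simp only [Finset.mem_inter, mem_nbr, Finset.mem_image, Finset.mem_univ, true_and,
        not_exists] at hz hzf
      refine ⟨⟨⟨fun w => if h : w = l then z else f ⟨w, h⟩, ?_⟩, ?_⟩, ?_⟩
      · intro a b hab
        by_cases ha : a = l
        · subst ha
          have hb := hu b hab
          subst hb
          simpa [hab.ne'] using hz.1.symm
        · by_cases hb : b = l
          · subst hb
            have ha' := hu a hab.symm
            subst ha'
            simpa [hab.ne] using hz.1
          · simp only [ha, hb, dite_false]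
            exact f.toHom.map_rel (by simpa using hab)
      · intro a b hab
        change (if h : a = l then z else f ⟨a, h⟩) = (if h : b = l then z else f ⟨b, h⟩) at hab
        by_cases ha : a = l <;> by_cases hb : b = l <;> simp only [ha, hb, dite_true, dite_false] at hab
        · rw [ha, hb]
        · exact absurd hab.symm (hzf _)
        · exact absurd hab (hzf _)
        · exact congrArg Subtype.val (f.injective hab)
      · intro w
        change (if h : w = l then z else f ⟨w, h⟩) ∈ S
        split_ifs
        · exact hz.2
        · exact hf _

/-- A graph without a subgraph of minimum degree at least `d` has an independent set containing at
least a `d`-th part of its vertices. -/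
theorem exists_indepSet_of_degenerate {V : Type*} [Fintype V] {G : SimpleGraph V} {d : ℕ}
    (S : Finset V)
    (h : ∀ S' ⊆ S, S'.Nonempty → ∃ v ∈ S', (G.nbr v ∩ S').card < d) :
    ∃ I ⊆ S, G.IsIndepSet (I : Set V) ∧ S.card ≤ d * I.card := by
  induction S using Finset.strongInduction with
  | H S ih =>
    rcases S.eq_empty_or_nonempty with rfl | hne
    · exact ⟨∅, by simp, by simp [IsIndepSet], by simp⟩
    obtain ⟨v, hv, hd⟩ := h S subset_rfl hne
    -- Putting `v` into the independent set costs at most `d` vertices of `S`: `v` and fewer than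
    -- `d` neighbours.
    set R := S \ insert v (G.nbr v) with hR
    have hRS : R ⊆ S := Finset.sdiff_subset
    obtain ⟨I, hI, hind, hc⟩ := ih R ⟨hRS, fun hh => by have := hh hv; simp [hR] at this⟩
      (fun S' hS' => h S' (hS'.trans hRS))
    have hvI : v ∉ I := fun hh => by have := hI hh; simp [hR] at this
    refine ⟨insert v I, Finset.insert_subset hv (hI.trans hRS), ?_, ?_⟩
    · rw [Finset.coe_insert, IsIndepSet, Set.pairwise_insert]
      refine ⟨hind, fun b hb _ => ?_⟩
      have := hI hb
      simp only [hR, Finset.mem_sdiff, Finset.mem_insert, mem_nbr, not_or] at this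
      exact ⟨this.2.2, fun h => this.2.2 h.symm⟩
    · rw [Finset.card_insert_of_notMem hvI, mul_add, mul_one]
      have h1 : S ⊆ R ∪ insert v (G.nbr v ∩ S) := by
        intro a ha
        by_cases h1 : a = v <;> by_cases h2 : G.Adj v a <;> simp [hR, ha, h1, h2]
      have h2 := (Finset.card_le_card h1).trans (Finset.card_union_le _ _)
      have h3 := Finset.card_insert_le v (G.nbr v ∩ S)
      omega

theorem IsTree.exists_copy_of_indepNum_lt {V W : Type*} [Fintype V] [Fintype W]
    {G : SimpleGraph V} {T : SimpleGraph W} (hT : T.IsTree) {S : Finset V}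
    (hS : Fintype.card W * G.indepNum < S.card) : ∃ f : Copy T G, ∀ w, f w ∈ S := by
  by_contra hcon
  obtain ⟨I, -, hI, hc⟩ := exists_indepSet_of_degenerate (G := G) (d := Fintype.card W) S (by
    intro S' hS' hne
    by_contra! hd
    obtain ⟨f, hf⟩ := hT.exists_copy_of_le_degree hne _ rfl hd
    exact hcon ⟨f, fun w => hS' (hf w)⟩)
  exact absurd (hc.trans (Nat.mul_le_mul_left _ hI.card_le_indepNum)) (not_le.2 hS)

/-- A set of vertices of `G` that is the vertex set of a `T`-tiling. -/
def Tileable {V W : Type*} (T : SimpleGraph W) (G : SimpleGraph V) (S : Finset V) : Prop :=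
  ∃ M : Set (Copy T G), T.IsTiling G M ∧ ∀ v, v ∈ S ↔ ∃ f ∈ M, v ∈ Set.range f

theorem tileable_empty {V W : Type*} (T : SimpleGraph W) (G : SimpleGraph V) :
    T.Tileable G ∅ := ⟨∅, by simp [IsTiling], by simp⟩

theorem tileable_image {V W : Type*} [Fintype W] {T : SimpleGraph W} {G : SimpleGraph V}
    (f : Copy T G) : T.Tileable G (Finset.univ.image f) :=
  ⟨{f}, by simp [IsTiling], by simp⟩

theorem Tileable.union {V W : Type*} {T : SimpleGraph W} {G : SimpleGraph V} {A B : Finset V}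
    (hA : T.Tileable G A) (hB : T.Tileable G B) (h : Disjoint A B) : T.Tileable G (A ∪ B) := by
  obtain ⟨M, hM, hMA⟩ := hA
  obtain ⟨N, hN, hNB⟩ := hB
  refine ⟨M ∪ N, ?_, fun v => ?_⟩
  · rw [IsTiling, Set.pairwiseDisjoint_union]
    refine ⟨hM, hN, fun f hf g hg _ => Set.disjoint_left.2 fun v hv hv' => ?_⟩
    exact Finset.disjoint_left.1 h ((hMA v).2 ⟨f, hf, hv⟩) ((hNB v).2 ⟨g, hg, hv'⟩)
  · simp only [Finset.mem_union, hMA, hNB, Set.mem_union]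
    constructor
    · rintro (⟨f, hf, h⟩ | ⟨f, hf, h⟩)
      exacts [⟨f, .inl hf, h⟩, ⟨f, .inr hf, h⟩]
    · rintro ⟨f, hf | hf, h⟩
      exacts [.inl ⟨f, hf, h⟩, .inr ⟨f, hf, h⟩]

theorem Tileable.biUnion {V W ι : Type*} {T : SimpleGraph W} {G : SimpleGraph V} {J : Finset ι}
    {S : ι → Finset V} (hS : ∀ j ∈ J, T.Tileable G (S j))
    (h : (J : Set ι).PairwiseDisjoint S) : T.Tileable G (J.biUnion S) := by
  induction J using Finset.induction_on with
  | empty => exact tileable_empty T G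
  | insert j J hj ih =>
    rw [Finset.biUnion_insert]
    refine (hS j (by simp)).union (ih (fun i hi => hS i (by simp [hi]))
      (h.subset (by simp))) ?_
    rw [Finset.disjoint_biUnion_right]
    exact fun i hi => h (by simp) (by simp [hi]) (fun e => hj (e ▸ hi))

/-- A set of vertices, containing `x`, that each further neighbour of `x` completes to the vertex
set of a copy of `T`. -/
structure IsCore {V W : Type*} [Fintype W] (T : SimpleGraph W) (G : SimpleGraph V) (x : V)
    (C : Finset V) : Prop where
  mem : x ∈ C
  card : C.card + 1 = Fintype.card W
  tileable : ∀ v ∉ C, G.Adj x v → T.Tileable G (insert v C)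

/-- Take a copy of the tree inside the neighbourhood of `x`. As `x` is adjacent to the whole copy,
it can take over the role of the parent `p` of a leaf `l`, and the place of `l` is then open to any
other neighbour of `x`. -/
theorem IsTree.exists_isCore {V W : Type*} [Fintype V] [Fintype W] [Nontrivial W]
    {G : SimpleGraph V} {T : SimpleGraph W} (hT : T.IsTree) {x : V} {S : Finset V}
    (hS : Fintype.card W * G.indepNum < S.card) (hx : S ⊆ G.nbr x) :
    ∃ C, T.IsCore G x C ∧ C ⊆ insert x S := by
  obtain ⟨f, hf⟩ := hT.exists_copy_of_indepNum_lt hS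
  obtain ⟨l, p, hlp, hu, -⟩ := hT.exists_leaf
  have hadj : ∀ w, G.Adj x (f w) := fun w => by simpa using hx (hf w)
  have hfx : ∀ w, f w ≠ x := fun w => (hadj w).ne'
  set D : Finset V := (Finset.univ \ {l, p}).image f with hD
  have hxD : x ∉ D := by simpa [hD] using fun a _ _ => hfx a
  refine ⟨insert x D, ⟨by simp, ?_, ?_⟩, ?_⟩
  · rw [Finset.card_insert_of_notMem hxD, Finset.card_image_of_injective _ (show Function.Injective f from f.injective),
      Finset.card_sdiff_of_subset (Finset.subset_univ _), Finset.card_pair hlp.ne, Finset.card_univ]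
    have := Fintype.one_lt_card (α := W)
    omega
  · intro v hv hxv
    have hvD : ∀ w, w ≠ l → w ≠ p → f w ≠ v := fun w h1 h2 h3 => hv (by
      rw [← h3]; simp only [hD, Finset.mem_insert, Finset.mem_image, Finset.mem_sdiff]
      exact Or.inr ⟨w, by simp [h1, h2], rfl⟩)
    let g : W → V := fun w => if w = l then v else if w = p then x else f w
    have hgl : g l = v := by simp [g]
    have hgp : g p = x := by simp [g, hlp.ne']
    have hgw : ∀ w, w ≠ l → w ≠ p → g w = f w := fun w h1 h2 => by simp [g, h1, h2]
    have hmap : ∀ a b, T.Adj a b → G.Adj (g a) (g b) := by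
      intro a b hab
      by_cases ha : a = l
      · subst ha
        rw [hu b hab, hgl, hgp]; exact hxv.symm
      by_cases hb : b = l
      · subst hb
        rw [hu a hab.symm, hgl, hgp]; exact hxv
      by_cases ha' : a = p
      · subst ha'
        rw [hgp, hgw b hb hab.ne']; exact hadj b
      by_cases hb' : b = p
      · subst hb'
        rw [hgp, hgw a ha hab.ne]; exact (hadj a).symm
      rw [hgw a ha ha', hgw b hb hb']
      exact f.toHom.map_rel hab
    have hvl : ∀ w, g w = v → w = l := fun w hw => by
      by_contra h1
      by_cases h2 : w = p
      · exact hxv.ne (by rw [← hw, h2, hgp])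
      · exact hvD w h1 h2 (by rw [← hw, hgw w h1 h2])
    have hxp : ∀ w, g w = x → w = p := fun w hw => by
      by_contra h2
      by_cases h1 : w = l
      · exact hxv.ne (by rw [← hw, h1, hgl])
      · exact hfx w (by rw [← hw, hgw w h1 h2])
    have hinj : Function.Injective g := by
      intro a b hab
      by_cases ha : a = l
      · exact ha.trans (hvl b (by rw [← hab, ha, hgl])).symm
      by_cases ha' : a = p
      · exact ha'.trans (hxp b (by rw [← hab, ha', hgp])).symm
      by_cases hb : b = l
      · exact absurd (hvl a (by rw [hab, hb, hgl])) ha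
      by_cases hb' : b = p
      · exact absurd (hxp a (by rw [hab, hb', hgp])) ha'
      rw [hgw a ha ha', hgw b hb hb'] at hab
      exact f.injective hab
    have key := tileable_image (⟨⟨g, fun {a b} => hmap a b⟩, hinj⟩ : Copy T G)
    have himg : (Finset.univ.image (⟨⟨g, fun {a b} => hmap a b⟩, hinj⟩ : Copy T G)) =
        insert v (insert x D) := by
      change Finset.univ.image g = _
      ext a
      simp only [Finset.mem_image, Finset.mem_univ, true_and, Finset.mem_insert, hD,
        Finset.mem_sdiff, Finset.mem_singleton, not_or]
      constructor
      · rintro ⟨w, rfl⟩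
        by_cases h1 : w = l
        · left; rw [h1, hgl]
        by_cases h2 : w = p
        · right; left; rw [h2, hgp]
        · right; right; exact ⟨w, ⟨h1, h2⟩, (hgw w h1 h2).symm⟩
      · rintro (rfl | rfl | ⟨w, ⟨h1, h2⟩, rfl⟩)
        exacts [⟨l, hgl⟩, ⟨p, hgp⟩, ⟨w, hgw w h1 h2⟩]
    rwa [himg] at key
  · refine Finset.insert_subset_insert _ ?_
    intro a ha
    simp only [hD, Finset.mem_image] at ha
    obtain ⟨w, -, rfl⟩ := ha
    exact hf w

end TreeTiling

/-! ### Classes of vertices with common, robustly reachable targets. -/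

section Clusters

open scoped Classical

theorem sum_le_card_filter_mul_add {α : Type*} (A : Finset α) (f : α → ℕ) {M t : ℝ} (ht : 0 ≤ t)
    (hM : ∀ x ∈ A, (f x : ℝ) ≤ M) :
    ((∑ x ∈ A, f x : ℕ) : ℝ) ≤ M * (A.filter fun x => t ≤ f x).card + t * A.card := by
  have h : ∀ x ∈ A, (f x : ℝ) ≤ (if t ≤ f x then M else 0) + t := by
    intro x hx
    split_ifs with h
    · linarith [hM x hx]
    · linarith
  push_cast
  refine (Finset.sum_le_sum h).trans ?_
  rw [Finset.sum_add_distrib, Finset.sum_const, ← Finset.sum_filter, Finset.sum_const, nsmul_eq_mul,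
    nsmul_eq_mul, mul_comm M, mul_comm t]

/-- Many common neighbours, iterated: two vertices are related at level `0` if they have at least
`γ n` common neighbours in `G`, and related at level `i + 1` if they are related at level `i` or have
at least `β n` common neighbours in the relation of level `i`. -/
def Linked {V : Type*} [Fintype V] (G : SimpleGraph V) (γ β : ℝ) : ℕ → V → V → Prop
  | 0, u, v => γ * Fintype.card V ≤ (G.nbr u ∩ G.nbr v).card
  | i + 1, u, v => Linked G γ β i u v ∨ β * Fintype.card V ≤
      (Finset.univ.filter fun w => Linked G γ β i u w ∧ Linked G γ β i v w).card

/-- The pairs `(x, y)` such that `v, x, y` is a walk ending in `S`. -/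
noncomputable def walks {V : Type*} [Fintype V] (G : SimpleGraph V) (v : V) (S : Finset V) :
    Finset (V × V) :=
  Finset.univ.filter fun p => G.Adj v p.1 ∧ G.Adj p.1 p.2 ∧ p.2 ∈ S

/-- The vertices from which `S` is reached by at most `l` double steps, each of which can be made in
at least `θ n ^ 2` ways. -/
noncomputable def reach {V : Type*} [Fintype V] (G : SimpleGraph V) (θ : ℝ) :
    ℕ → Finset V → Finset V
  | 0, S => S
  | l + 1, S => reach G θ l S ∪ Finset.univ.filter fun v =>
      θ * (Fintype.card V : ℝ) ^ 2 ≤ (G.walks v (reach G θ l S)).card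

variable {V : Type*} [Fintype V] {G : SimpleGraph V}

theorem mem_reach_succ {θ : ℝ} {l : ℕ} {S : Finset V} {v : V} :
    v ∈ G.reach θ (l + 1) S ↔ v ∈ G.reach θ l S ∨
      θ * (Fintype.card V : ℝ) ^ 2 ≤ (G.walks v (G.reach θ l S)).card := by
  rw [reach, Finset.mem_union, Finset.mem_filter, and_iff_right (Finset.mem_univ v)]

theorem linked_succ {γ β : ℝ} {i : ℕ} {u v : V} : G.Linked γ β (i + 1) u v ↔
    G.Linked γ β i u v ∨ β * Fintype.card V ≤
      (Finset.univ.filter fun w => G.Linked γ β i u w ∧ G.Linked γ β i v w).card := Iff.rfl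

theorem Linked.symm {γ β : ℝ} {i : ℕ} : ∀ {u v : V}, G.Linked γ β i u v → G.Linked γ β i v u := by
  induction i with
  | zero => intro u v h; simpa only [Linked, Finset.inter_comm] using h
  | succ i ih =>
    intro u v h
    rcases h with h | h
    · exact .inl (ih h)
    · exact .inr (by simpa only [and_comm] using h)

theorem Linked.mono {γ β : ℝ} {i j : ℕ} {u v : V} (hij : i ≤ j) (h : G.Linked γ β i u v) :
    G.Linked γ β j u v := by
  induction hij with
  | refl => exact h
  | step _ ih => exact .inl ih

theorem walks_mono (v : V) {S S' : Finset V} (h : S ⊆ S') : G.walks v S ⊆ G.walks v S' := by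
  intro p hp
  simp only [walks, Finset.mem_filter, Finset.mem_univ, true_and] at hp ⊢
  exact ⟨hp.1, hp.2.1, h hp.2.2⟩

theorem reach_add (θ : ℝ) (l m : ℕ) (S : Finset V) :
    G.reach θ m (G.reach θ l S) = G.reach θ (l + m) S := by
  induction m with
  | zero => rfl
  | succ m ih => rw [show l + (m + 1) = l + m + 1 from rfl, reach, ih, reach]

theorem reach_subset_of_le (θ : ℝ) {l m : ℕ} (h : l ≤ m) (S : Finset V) :
    G.reach θ l S ⊆ G.reach θ m S := by
  induction h with
  | refl => exact subset_rfl
  | step _ ih => exact ih.trans Finset.subset_union_left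

theorem reach_subset_reach {θ θ' : ℝ} (h : θ' ≤ θ) (l : ℕ) {S S' : Finset V} (hS : S ⊆ S') :
    G.reach θ l S ⊆ G.reach θ' l S' := by
  induction l with
  | zero => exact hS
  | succ l ih =>
    refine Finset.union_subset_union ih fun v hv => ?_
    simp only [Finset.mem_filter, Finset.mem_univ, true_and] at hv ⊢
    calc θ' * (Fintype.card V : ℝ) ^ 2 ≤ θ * (Fintype.card V : ℝ) ^ 2 := by gcongr
      _ ≤ _ := hv
      _ ≤ _ := by exact_mod_cast Finset.card_le_card (walks_mono v ih)

theorem card_walks (v : V) (S : Finset V) :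
    (G.walks v S).card = ∑ w ∈ S, (G.nbr v ∩ G.nbr w).card := by
  rw [Finset.card_eq_sum_card_fiberwise (f := Prod.snd) (t := S)
    (fun p hp => by simp [walks] at hp; exact hp.2.2)]
  refine Finset.sum_congr rfl fun w hw => ?_
  refine Finset.card_bij' (fun p _ => p.1) (fun x _ => (x, w)) ?_ ?_ ?_ ?_
  · rintro ⟨x, y⟩ h
    simp only [walks, Finset.mem_filter, Finset.mem_univ, true_and, Finset.mem_inter,
      mem_nbr] at h ⊢
    obtain ⟨h, rfl⟩ := h
    exact ⟨h.1, h.2.1.symm⟩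
  · intro x h
    simp only [walks, Finset.mem_filter, Finset.mem_univ, true_and, Finset.mem_inter, mem_nbr,
      and_true] at h ⊢
    exact ⟨h.1, h.2.symm, hw⟩
  · rintro ⟨x, y⟩ h
    simp only [walks, Finset.mem_filter] at h
    simp [h.2]
  · simp

theorem mem_reach_one {γ β τ : ℝ} (hγ : 0 ≤ γ) {S : Finset V} {v : V}
    (h : τ * Fintype.card V ≤ (S.filter fun w => G.Linked γ β 0 v w).card) :
    v ∈ G.reach (τ * γ) 1 S := by
  refine mem_reach_succ.2 (.inr ?_)
  have h1 : ∀ w ∈ S.filter (fun w => G.Linked γ β 0 v w),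
      γ * Fintype.card V ≤ ((G.nbr v ∩ G.nbr w).card : ℝ) := by
    intro w hw
    exact (Finset.mem_filter.1 hw).2
  have h2 := Finset.card_nsmul_le_sum _ _ _ h1
  rw [nsmul_eq_mul] at h2
  calc τ * γ * (Fintype.card V : ℝ) ^ 2 = (τ * Fintype.card V) * (γ * Fintype.card V) := by ring
    _ ≤ _ := by gcongr
    _ ≤ _ := h2
    _ ≤ _ := by
      rw [reach, card_walks]
      push_cast
      exact Finset.sum_le_sum_of_subset_of_nonneg (Finset.filter_subset _ _)
        (fun _ _ _ => by positivity)

/-- Unfolds iterated links into robust double steps. A link of level `i + 1` passes through many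
intermediate vertices `y`; by double counting, many of these are linked at level `i` both to `v` and
to many vertices of `S`, so the induction hypothesis applies twice. The constants depend on neither
the graph nor its order. -/
theorem exists_mem_reach_of_linked {γ β : ℝ} (hγ : 0 < γ) (hβ : 0 < β) (i : ℕ) :
    ∀ τ : ℝ, 0 < τ → ∃ θ : ℝ, 0 < θ ∧ ∃ l : ℕ, ∀ {V : Type*} [Fintype V] {G : SimpleGraph V}
      {S : Finset V} {v : V}, τ * Fintype.card V ≤ (S.filter fun w => G.Linked γ β i v w).card →
        v ∈ G.reach θ l S := by
  induction i with
  | zero => exact fun τ hτ => ⟨τ * γ, by positivity, 1, fun h => mem_reach_one hγ.le h⟩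
  | succ i ih =>
    intro τ hτ
    obtain ⟨θ₀, hθ₀, l₀, h₀⟩ := ih (τ / 2) (by positivity)
    obtain ⟨θ₁, hθ₁, l₁, h₁⟩ := ih (τ * β / 4) (by positivity)
    refine ⟨min θ₀ θ₁, lt_min hθ₀ hθ₁, max l₀ (l₁ + l₁), fun {V} _ {G S v} h => ?_⟩
    set n : ℝ := (Fintype.card V : ℝ) with hn
    have hn0 : 0 < n := by rw [hn]; exact_mod_cast Fintype.card_pos_iff.2 ⟨v⟩
    -- Either half of the links already exist at level `i`, or half of them are genuinely new and
    -- pass through `β n` intermediate vertices.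
    by_cases hS : τ / 2 * n ≤ (S.filter fun w => G.Linked γ β i v w).card
    · exact reach_subset_of_le _ (le_max_left _ _) _
        (reach_subset_reach (min_le_left _ _) _ subset_rfl (h₀ hS))
    refine reach_subset_of_le _ (le_max_right _ _) _
      (reach_subset_reach (min_le_right _ _) _ subset_rfl ?_)
    rw [← reach_add]
    set S₂ := S.filter fun w => β * n ≤
      (Finset.univ.filter fun y => G.Linked γ β i v y ∧ G.Linked γ β i w y).card with hS₂
    have hcard : τ / 2 * n ≤ S₂.card := by
      have h1 : (S.filter fun w => G.Linked γ β (i + 1) v w).card ≤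
          (S.filter fun w => G.Linked γ β i v w).card + S₂.card := by
        refine le_trans (Finset.card_le_card ?_) (Finset.card_union_le _ _)
        intro w hw
        rw [Finset.mem_filter, linked_succ] at hw
        rw [Finset.mem_union, Finset.mem_filter, hS₂, Finset.mem_filter]
        exact hw.2.imp (fun h => ⟨hw.1, h⟩) (fun h => ⟨hw.1, h⟩)
      have h2 : ((S.filter fun w => G.Linked γ β (i + 1) v w).card : ℝ) ≤
          (S.filter fun w => G.Linked γ β i v w).card + S₂.card := by exact_mod_cast h1
      linarith
    set A := Finset.univ.filter fun y => G.Linked γ β i v y with hA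
    have hsum : ∑ y ∈ A, (S₂.filter fun w => G.Linked γ β i y w).card =
        ∑ w ∈ S₂, (Finset.univ.filter fun y => G.Linked γ β i v y ∧ G.Linked γ β i w y).card := by
      have hdc := Finset.sum_card_bipartiteAbove_eq_sum_card_bipartiteBelow (s := A) (t := S₂)
        (fun y w => G.Linked γ β i y w)
      simp only [Finset.bipartiteAbove, Finset.bipartiteBelow] at hdc
      rw [hdc]
      refine Finset.sum_congr rfl fun w _ => ?_
      congr 1
      ext y
      simp only [hA, Finset.mem_filter, Finset.mem_univ, true_and]
      exact and_congr_right fun _ => ⟨Linked.symm, Linked.symm⟩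
    have hlow : τ / 2 * n * (β * n) ≤
        ((∑ y ∈ A, (S₂.filter fun w => G.Linked γ β i y w).card : ℕ) : ℝ) := by
      rw [hsum]
      have := Finset.card_nsmul_le_sum S₂ (fun w => ((Finset.univ.filter fun y =>
        G.Linked γ β i v y ∧ G.Linked γ β i w y).card : ℝ)) (β * n)
        (fun w hw => (Finset.mem_filter.1 hw).2)
      rw [nsmul_eq_mul] at this
      push_cast
      refine le_trans ?_ this
      gcongr
    have hup := sum_le_card_filter_mul_add A (fun y => (S₂.filter fun w => G.Linked γ β i y w).card)
      (M := n) (t := τ * β / 4 * n) (by positivity)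
      (fun y _ => by rw [hn]; exact_mod_cast Finset.card_le_univ _)
    have hAn : (A.card : ℝ) ≤ n := by rw [hn]; exact_mod_cast Finset.card_le_univ _
    apply h₁
    have h3 : τ * β / 4 * n ≤ ((A.filter fun y => τ * β / 4 * n ≤
        ((S₂.filter fun w => G.Linked γ β i y w).card : ℝ)).card : ℝ) := by
      have h4 : τ * β / 4 * n * A.card ≤ τ * β / 4 * n * n := by gcongr
      refine le_of_mul_le_mul_left ?_ hn0
      nlinarith
    refine h3.trans ?_
    exact_mod_cast Finset.card_le_card fun y hy => by
      simp only [Finset.mem_filter, hA, Finset.mem_univ, true_and] at hy ⊢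
      refine ⟨h₁ (hy.2.trans ?_), hy.1⟩
      exact_mod_cast Finset.card_le_card (Finset.filter_subset_filter _ (Finset.filter_subset _ _))

/-- Otherwise each descent by one level, starting with the empty set at level `c + 1`, gains a
vertex, giving `c + 1` independent vertices at level `0`. The resulting `I` is sparse for level `i +
1` and yet as large as any independent set of level `i`. -/
theorem exists_stable_indep {V : Type*} [Fintype V] (R : ℕ → V → V → Prop) (c : ℕ)
    (h : ∀ I : Finset V, (I : Set V).Pairwise (fun a b => ¬ R 0 a b) → I.card ≤ c) :
    ∃ i ≤ c, ∃ I : Finset V, (I : Set V).Pairwise (fun a b => ¬ R (i + 1) a b) ∧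
      ∀ J : Finset V, (J : Set V).Pairwise (fun a b => ¬ R i a b) → J.card ≤ I.card := by
  by_contra! H
  have key : ∀ m ≤ c + 1, ∃ I : Finset V,
      (I : Set V).Pairwise (fun a b => ¬ R (c + 1 - m) a b) ∧ m ≤ I.card := by
    intro m
    induction m with
    | zero => exact fun _ => ⟨∅, by simp, by simp⟩
    | succ m ih =>
      intro hm
      obtain ⟨I, hI, hc⟩ := ih (by omega)
      have e : c + 1 - m = c + 1 - (m + 1) + 1 := by omega
      rw [e] at hI
      obtain ⟨J, hJ, hJc⟩ := H (c + 1 - (m + 1)) (by omega) I hI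
      exact ⟨J, hJ, by omega⟩
  obtain ⟨I, hI, hc⟩ := key (c + 1) le_rfl
  have := h I (by simpa using hI)
  omega

/-- Inclusion-exclusion for `c + 1` neighbourhoods of size at least `η n` with pairwise
intersections below `γ n`. -/
theorem card_le_of_pairwise_not_linked {γ β η : ℝ} {c : ℕ} (hγ : 0 < γ)
    (hc : ((c : ℝ) + 1) ^ 2 * γ ≤ (c + 1) * η - 1)
    (hδ : ∀ v, η * Fintype.card V ≤ (G.nbr v).card) (I : Finset V)
    (hI : (I : Set V).Pairwise (fun a b => ¬ G.Linked γ β 0 a b)) : I.card ≤ c := by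
  by_contra! hlt
  obtain ⟨J, hJI, hJ⟩ := Finset.exists_subset_card_eq (Nat.succ_le_of_lt hlt)
  have hne : J.Nonempty := by rw [← Finset.card_pos]; omega
  obtain ⟨v₀, -⟩ := hne
  set n : ℝ := (Fintype.card V : ℝ) with hn
  have hn0 : 0 < n := by rw [hn]; exact_mod_cast Fintype.card_pos_iff.2 ⟨v₀⟩
  have h1 : ∑ a ∈ J, (G.nbr a).card = ∑ v : V, (J.filter fun a => G.Adj a v).card := by
    have := Finset.sum_card_bipartiteAbove_eq_sum_card_bipartiteBelow (s := J)
      (t := (Finset.univ : Finset V)) (fun a v => G.Adj a v)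
    simpa [Finset.bipartiteAbove, Finset.bipartiteBelow, nbr] using this
  have h2 : ∑ v : V, (J.filter fun a => G.Adj a v).offDiag.card =
      ∑ p ∈ J.offDiag, (G.nbr p.1 ∩ G.nbr p.2).card := by
    have := Finset.sum_card_bipartiteAbove_eq_sum_card_bipartiteBelow (s := J.offDiag)
      (t := (Finset.univ : Finset V)) (fun p v => G.Adj p.1 v ∧ G.Adj p.2 v)
    simp only [Finset.bipartiteAbove, Finset.bipartiteBelow] at this
    calc _ = _ := Finset.sum_congr rfl fun v _ => congrArg _ ?_
      _ = _ := this.symm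
      _ = _ := Finset.sum_congr rfl fun p _ => congrArg _ ?_
    · ext p
      simp only [Finset.mem_offDiag, Finset.mem_filter]
      tauto
    · ext v
      simp
  -- Vertex by vertex this is `d ≤ 1 + d (d - 1)`, where `d` counts the neighbourhoods containing
  -- the vertex.
  have h3 : ∑ a ∈ J, (G.nbr a).card ≤ Fintype.card V +
      ∑ p ∈ J.offDiag, (G.nbr p.1 ∩ G.nbr p.2).card := by
    rw [h1, ← h2, Fintype.card_eq_sum_ones, ← Finset.sum_add_distrib]
    refine Finset.sum_le_sum fun v _ => ?_
    rw [Finset.offDiag_card]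
    generalize (J.filter fun a => G.Adj a v).card = d
    rcases d with _ | _ | d
    · simp
    · simp
    · have : (d + 1 + 1) * (d + 1 + 1) = (d + 1 + 1) + (d + 1 + 1) * (d + 1) := by ring
      rw [this, Nat.add_sub_cancel_left]
      nlinarith
  have h4 : ((c : ℝ) + 1) * (η * n) ≤ ((∑ a ∈ J, (G.nbr a).card : ℕ) : ℝ) := by
    have := Finset.card_nsmul_le_sum J (fun a => ((G.nbr a).card : ℝ)) (η * n) (fun a _ => hδ a)
    rw [nsmul_eq_mul, hJ] at this
    push_cast at this ⊢
    exact this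
  have h5 : ((∑ p ∈ J.offDiag, (G.nbr p.1 ∩ G.nbr p.2).card : ℕ) : ℝ) ≤
      (c + 1) * c * (γ * n) := by
    have := Finset.sum_le_card_nsmul J.offDiag
      (fun p => ((G.nbr p.1 ∩ G.nbr p.2).card : ℝ)) (γ * n) (fun p hp => by
        rw [Finset.mem_offDiag] at hp
        exact (not_le.1 (hI (hJI hp.1) (hJI hp.2.1) hp.2.2)).le)
    rw [nsmul_eq_mul, Finset.offDiag_card, hJ] at this
    have e : (c + 1) * (c + 1) - (c + 1) = (c + 1) * c := by
      rw [Nat.mul_succ, Nat.add_sub_cancel]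
    rw [Nat.succ_eq_add_one, e] at this
    push_cast at this ⊢
    exact this
  have h6 : ((∑ a ∈ J, (G.nbr a).card : ℕ) : ℝ) ≤ n +
      ((∑ p ∈ J.offDiag, (G.nbr p.1 ∩ G.nbr p.2).card : ℕ) : ℝ) := by
    rw [hn]; exact_mod_cast h3
  have h7 : ((c : ℝ) + 1) * (η * n) ≤ n + (c + 1) * c * (γ * n) := by linarith
  have h8 : ((c : ℝ) + 1) ^ 2 * γ * n ≤ ((c + 1) * η - 1) * n := by gcongr
  have h9 : 0 < ((c : ℝ) + 1) * (γ * n) := by positivity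
  nlinarith

theorem sum_card_nbr_inter (S : Finset V) :
    ∑ z : V, (G.nbr z ∩ S).card = ∑ w ∈ S, (G.nbr w).card := by
  have := Finset.sum_card_bipartiteAbove_eq_sum_card_bipartiteBelow (s := S)
    (t := (Finset.univ : Finset V)) (fun a v => G.Adj a v)
  simp only [Finset.bipartiteAbove, Finset.bipartiteBelow] at this
  rw [show ∑ w ∈ S, (G.nbr w).card = _ from this]
  refine Finset.sum_congr rfl fun v _ => congrArg _ ?_
  ext w
  simp [adj_comm, and_comm]

theorem card_filter_le_nbr_inter {η ρ t : ℝ} (hη : 0 ≤ η) (ht : 0 ≤ t)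
    (hδ : ∀ v, η * Fintype.card V ≤ (G.nbr v).card) {S : Finset V}
    (hS : ρ * Fintype.card V ≤ S.card) :
    (ρ * η - t) * Fintype.card V ≤
      (Finset.univ.filter fun z => t * Fintype.card V ≤ (G.nbr z ∩ S).card).card := by
  rcases isEmpty_or_nonempty V with h | h
  · simp
  set n : ℝ := (Fintype.card V : ℝ) with hn
  have hn0 : 0 < n := by rw [hn]; exact_mod_cast Fintype.card_pos
  have h1 := sum_le_card_filter_mul_add (Finset.univ : Finset V) (fun z => (G.nbr z ∩ S).card)
    (M := n) (t := t * n) (by positivity) (fun y _ => by rw [hn]; exact_mod_cast Finset.card_le_univ _)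
  rw [sum_card_nbr_inter, Finset.card_univ] at h1
  have h2 := Finset.card_nsmul_le_sum S (fun a => ((G.nbr a).card : ℝ)) (η * n) (fun a _ => hδ a)
  rw [nsmul_eq_mul] at h2
  have h3 : ρ * n * (η * n) ≤ S.card * (η * n) := by gcongr
  push_cast at h1
  refine le_of_mul_le_mul_left ?_ hn0
  nlinarith

/-- The classes are indexed by the set `I` from `exists_stable_indep`. Being maximal at level `i`,
it makes the vertices linked to exactly one `v ∈ I` into a clique `K v` of the level-`i` relation;
being independent at level `i + 1`, it leaves few vertices linked to two members. Each `u` is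
assigned to a clique in which it has many level-`0` links, and the targets of `v` are the vertices
with many neighbours in `K v`. -/
theorem exists_clusters {η : ℝ} (hη : 0 < η) (hη1 : η ≤ 1) :
    ∃ θ : ℝ, 0 < θ ∧ ∃ l : ℕ, ∀ {V : Type*} [Fintype V] {G : SimpleGraph V},
      (∀ v, η * Fintype.card V ≤ (G.nbr v).card) →
      ∃ (cls : V → V) (Z : V → Finset V), (Finset.univ.image cls).card ≤ ⌊1 / η⌋₊ ∧
        ∀ u, θ * Fintype.card V ≤ (Z (cls u)).card ∧
          ∀ z ∈ Z (cls u), u ∈ G.reach θ l (G.nbr z) := by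
  set c := ⌊1 / η⌋₊ with hc
  have hc1 : (1 : ℝ) ≤ c := by
    have : 1 ≤ c := Nat.le_floor (by rw [Nat.cast_one, le_div_iff₀ hη]; linarith)
    exact_mod_cast this
  have hc2 : 0 < ((c : ℝ) + 1) * η - 1 := by
    have := Nat.lt_floor_add_one (1 / η)
    rw [div_lt_iff₀ hη] at this
    linarith
  set γ : ℝ := min (((c + 1) * η - 1) / ((c : ℝ) + 1) ^ 2) (η ^ 2 / 2) with hγdef
  have hγ : 0 < γ := lt_min (by positivity) (by positivity)
  have hγ1 : ((c : ℝ) + 1) ^ 2 * γ ≤ (c + 1) * η - 1 := by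
    have := min_le_left (((c + 1) * η - 1) / ((c : ℝ) + 1) ^ 2) (η ^ 2 / 2)
    rw [← hγdef, le_div_iff₀ (by positivity)] at this
    linarith
  have hγ2 : γ ≤ η ^ 2 / 2 := min_le_right _ _
  set β : ℝ := η ^ 2 / (4 * c ^ 2) with hβdef
  have hβ : 0 < β := by positivity
  set ρ : ℝ := η ^ 2 / (4 * c) with hρdef
  have hρ : 0 < ρ := by positivity
  obtain ⟨θ₁, hθ₁, l, hreach⟩ := exists_mem_reach_of_linked hγ hβ c (ρ * η / 2) (by positivity)
  refine ⟨min θ₁ (min (ρ * γ) (ρ * η / 2)), by positivity, l + 1, fun {V} _ {G} hδ => ?_⟩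
  set n : ℝ := (Fintype.card V : ℝ) with hn
  obtain ⟨i, hic, I, hI, hmax⟩ := exists_stable_indep (G.Linked γ β) c
    (card_le_of_pairwise_not_linked hγ hγ1 hδ)
  have hIc : I.card ≤ c := card_le_of_pairwise_not_linked hγ hγ1 hδ I
    (hI.mono' fun a b h h' => h (h'.mono (Nat.zero_le _)))
  have hIi : (I : Set V).Pairwise (fun a b => ¬ G.Linked γ β i a b) :=
    hI.mono' fun a b h h' => h (h'.mono (Nat.le_succ _))
  have hrefl : ∀ v, G.Linked γ β i v v := by
    intro v
    refine Linked.mono (Nat.zero_le i) ?_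
    simp only [Linked, Finset.inter_self]
    refine le_trans ?_ (hδ v)
    gcongr
    nlinarith
  have hcover : ∀ u, ∃ v ∈ I, G.Linked γ β i u v := by
    intro u
    by_contra! hu
    have huI : u ∉ I := fun h => hu u h (hrefl u)
    have := hmax (insert u I) (by
      rw [Finset.coe_insert, Set.pairwise_insert]
      exact ⟨hIi, fun b hb _ => ⟨hu b hb, fun h => hu b hb h.symm⟩⟩)
    rw [Finset.card_insert_of_notMem huI] at this
    omega
  set K : V → Finset V := fun v => Finset.univ.filter fun u => G.Linked γ β i u v ∧
    ∀ w ∈ I, w ≠ v → ¬ G.Linked γ β i u w with hK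
  have hclique : ∀ v ∈ I, ∀ u ∈ K v, ∀ w ∈ K v, G.Linked γ β i u w := by
    intro v hv u hu w hw
    by_contra huw
    have hne : u ≠ w := fun h => huw (h ▸ hrefl u)
    simp only [hK, Finset.mem_filter, Finset.mem_univ, true_and] at hu hw
    have hu' : u ∉ I.erase v := fun h => hu.2 u (Finset.mem_of_mem_erase h)
      (Finset.ne_of_mem_erase h) (hrefl u)
    have hw' : w ∉ I.erase v := fun h => hw.2 w (Finset.mem_of_mem_erase h)
      (Finset.ne_of_mem_erase h) (hrefl w)
    -- Exchange: two unlinked vertices of `K v` could replace `v` and enlarge `I`.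
    have := hmax (insert u (insert w (I.erase v))) (by
      rw [Finset.coe_insert, Set.pairwise_insert, Finset.coe_insert, Set.pairwise_insert]
      refine ⟨⟨hIi.mono (by simp), fun b hb _ => ?_⟩, fun b hb _ => ?_⟩
      · have hb' : b ∈ I.erase v := hb
        have := hw.2 b (Finset.mem_of_mem_erase hb') (Finset.ne_of_mem_erase hb')
        exact ⟨this, fun h => this h.symm⟩
      · rcases hb with rfl | hb
        · exact ⟨huw, fun h => huw h.symm⟩
        · have hb' : b ∈ I.erase v := hb
          have := hu.2 b (Finset.mem_of_mem_erase hb') (Finset.ne_of_mem_erase hb')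
          exact ⟨this, fun h => this h.symm⟩)
    rw [Finset.card_insert_of_notMem (by simp [hne] at hu' ⊢; exact hu'),
      Finset.card_insert_of_notMem hw', Finset.card_erase_of_mem hv] at this
    have := Finset.card_pos.2 ⟨v, hv⟩
    omega
  set B : Finset V := I.offDiag.biUnion fun p =>
    Finset.univ.filter fun u => G.Linked γ β i p.1 u ∧ G.Linked γ β i p.2 u with hB
  have hBcard : (B.card : ℝ) ≤ η ^ 2 / 4 * n := by
    have h1 : (B.card : ℝ) ≤ ∑ p ∈ I.offDiag, ((Finset.univ.filter fun u =>
        G.Linked γ β i p.1 u ∧ G.Linked γ β i p.2 u).card : ℝ) := by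
      exact_mod_cast Finset.card_biUnion_le
    have h2 := Finset.sum_le_card_nsmul I.offDiag (fun p => ((Finset.univ.filter fun u =>
        G.Linked γ β i p.1 u ∧ G.Linked γ β i p.2 u).card : ℝ)) (β * n) (fun p hp => by
      rw [Finset.mem_offDiag] at hp
      have := hI hp.1 hp.2.1 hp.2.2
      simp only [Linked, not_or, not_le] at this
      exact this.2.le)
    have h3 : (I.offDiag.card : ℝ) ≤ c ^ 2 := by
      have : I.offDiag.card ≤ c ^ 2 := by
        rw [Finset.offDiag_card, sq]
        exact (Nat.sub_le _ _).trans (Nat.mul_le_mul hIc hIc)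
      exact_mod_cast this
    rw [nsmul_eq_mul] at h2
    calc (B.card : ℝ) ≤ _ := h1.trans h2
      _ ≤ c ^ 2 * (β * n) := by gcongr
      _ = _ := by rw [hβdef]; field_simp
  -- At least `η ^ 2 / 2 * n` vertices are linked to `u` at level `0`, at most half that many lie in
  -- `B`, and at most `c` cliques share the rest.
  have hcls : ∀ u, ∃ v ∈ I, ρ * n ≤ ((K v).filter fun w => G.Linked γ β 0 u w).card := by
    intro u
    by_contra! hlt
    have h1 := card_filter_le_nbr_inter hη.le hγ.le hδ (hδ u)
    set A := Finset.univ.filter fun z => γ * n ≤ ((G.nbr z ∩ G.nbr u).card : ℝ) with hA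
    have hsub : A ⊆ B ∪ I.biUnion fun v => (K v).filter fun w => G.Linked γ β 0 u w := by
      intro w hw
      simp only [hA, Finset.mem_filter, Finset.mem_univ, true_and] at hw
      by_cases hwB : w ∈ B
      · exact Finset.mem_union_left _ hwB
      refine Finset.mem_union_right _ ?_
      obtain ⟨v, hv, hwv⟩ := hcover w
      simp only [Finset.mem_biUnion, Finset.mem_filter]
      refine ⟨v, hv, ?_, ?_⟩
      · simp only [hK, Finset.mem_filter, Finset.mem_univ, true_and]
        refine ⟨hwv, fun v' hv' hne h => hwB ?_⟩
        simp only [hB, Finset.mem_biUnion, Finset.mem_filter, Finset.mem_univ, true_and]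
        exact ⟨(v, v'), Finset.mem_offDiag.2 ⟨hv, hv', hne.symm⟩, hwv.symm, h.symm⟩
      · simpa only [Linked, Finset.inter_comm] using hw
    have h2 : (A.card : ℝ) ≤ B.card + ∑ v ∈ I,
        (((K v).filter fun w => G.Linked γ β 0 u w).card : ℝ) := by
      have := (Finset.card_le_card hsub).trans (Finset.card_union_le _ _)
      have h' := this.trans (Nat.add_le_add_left Finset.card_biUnion_le _)
      exact_mod_cast h'
    obtain ⟨v₀, hv₀, -⟩ := hcover u
    have h3 := Finset.sum_lt_sum_of_nonempty ⟨v₀, hv₀⟩ hlt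
    rw [Finset.sum_const, nsmul_eq_mul] at h3
    have h4 : (I.card : ℝ) * (ρ * n) ≤ c * (ρ * n) := by gcongr
    have h5 : (c : ℝ) * (ρ * n) = η ^ 2 / 4 * n := by rw [hρdef]; field_simp
    have h6 : η ^ 2 / 2 * n ≤ (η * η - γ) * n := by gcongr; nlinarith
    linarith
  choose cls hclsI hclsK using hcls
  refine ⟨cls, fun v => Finset.univ.filter fun z => ρ * η / 2 * n ≤ ((G.nbr z ∩ K v).card : ℝ), ?_,
    fun u => ⟨?_, fun z hz => ?_⟩⟩
  · refine (Finset.card_le_card ?_).trans hIc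
    intro v hv
    obtain ⟨u, -, rfl⟩ := Finset.mem_image.1 hv
    exact hclsI u
  · have hKc : ρ * n ≤ ((K (cls u)).card : ℝ) := (hclsK u).trans
      (by exact_mod_cast Finset.card_le_card (Finset.filter_subset _ _))
    refine le_trans ?_ (card_filter_le_nbr_inter hη.le (by positivity) hδ hKc)
    have : min θ₁ (min (ρ * γ) (ρ * η / 2)) ≤ ρ * η / 2 := (min_le_right _ _).trans (min_le_right _ _)
    gcongr
    linarith
  · simp only [Finset.mem_filter, Finset.mem_univ, true_and] at hz
    -- One double step leads from `u` to many `y ∈ K (cls u)`; each such `y` is linked to all of the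
    -- clique, hence to many neighbours of `z`.
    rw [← reach_add]
    refine reach_subset_reach ((min_le_right _ _).trans (min_le_left _ _)) 1
      (reach_subset_reach (min_le_left _ _) l subset_rfl) (mem_reach_one hγ.le (β := β) ?_)
    refine (hclsK u).trans ?_
    exact_mod_cast Finset.card_le_card fun y hy => by
      rw [Finset.mem_filter] at hy ⊢
      refine ⟨hreach (hz.trans ?_), hy.2⟩
      exact_mod_cast Finset.card_le_card fun w hw => by
        rw [Finset.mem_inter] at hw
        exact Finset.mem_filter.2 ⟨hw.1, (hclique _ (hclsI u) y hy.1 w hw.2).mono hic⟩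

end Clusters

/-! ### Helper systems that hit every prescribed event. -/

section Helpers

open scoped Classical

theorem exists_mem_mul_sum_le {α : Type*} [Fintype α] [DecidableEq α] (F : Finset (Finset α)) (A : Finset α)
    (w : Finset α → ℝ) (hw : ∀ E ∈ F, 0 ≤ w E) {a : ℝ} (hA : A.Nonempty)
    (h : ∀ E ∈ F, a ≤ (E ∩ A).card) :
    ∃ p ∈ A, a * ∑ E ∈ F, w E ≤ Fintype.card α * ∑ E ∈ F.filter (p ∈ ·), w E := by
  have hA0 : (0 : ℝ) < A.card := by exact_mod_cast hA.card_pos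
  have h1 : ∑ p ∈ A, ∑ E ∈ F.filter (p ∈ ·), w E = ∑ E ∈ F, w E * (E ∩ A).card := by
    simp_rw [Finset.sum_filter]
    rw [Finset.sum_comm]
    refine Finset.sum_congr rfl fun E _ => ?_
    rw [← Finset.sum_filter, Finset.sum_const, nsmul_eq_mul, mul_comm, Finset.inter_comm,
      Finset.filter_mem_eq_inter]
  obtain ⟨p, hp, hpA⟩ := Finset.exists_le_of_sum_le (s := A)
    (f := fun _ => a * (∑ E ∈ F, w E) / A.card) (g := fun p => ∑ E ∈ F.filter (p ∈ ·), w E) hA (by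
      rw [Finset.sum_const, nsmul_eq_mul, mul_div_cancel₀ _ hA0.ne', h1, Finset.mul_sum]
      refine Finset.sum_le_sum fun E hE => ?_
      rw [mul_comm]
      exact mul_le_mul_of_nonneg_left (h E hE) (hw E hE))
  refine ⟨p, hp, ?_⟩
  rw [div_le_iff₀ hA0] at hpA
  refine hpA.trans ((mul_comm _ _).trans_le (mul_le_mul_of_nonneg_right ?_
    (Finset.sum_nonneg fun E hE => hw E (Finset.mem_filter.1 hE).1)))
  exact_mod_cast Finset.card_le_univ _

/-- A triple `(x, y, C)` where `C` is a core at `x` and `y` a neighbour of `x` that completes it. -/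
structure IsHelper {V W : Type*} [Fintype W] (T : SimpleGraph W) (G : SimpleGraph V)
    (h : V × V × Finset V) : Prop where
  core : T.IsCore G h.1 h.2.2
  notMem : h.2.1 ∉ h.2.2
  adj : G.Adj h.1 h.2.1

/-- The vertices of a helper. -/
noncomputable def cell {V : Type*} (h : V × V × Finset V) : Finset V := insert h.2.1 h.2.2

/-- A set of pairwise disjoint helpers. -/
structure IsHelperSystem {V W : Type*} [Fintype W] (T : SimpleGraph W) (G : SimpleGraph V)
    (J : Finset (V × V × Finset V)) : Prop where
  isHelper : ∀ h ∈ J, T.IsHelper G h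
  disjoint : (J : Set (V × V × Finset V)).PairwiseDisjoint cell

/-- The number of helpers whose pair `(x, y)` lies in `E`. -/
noncomputable def hits {V : Type*} (J : Finset (V × V × Finset V)) (E : Finset (V × V)) : ℕ :=
  (J.filter fun h => (h.1, h.2.1) ∈ E).card

variable {V W : Type*} [Fintype W] {T : SimpleGraph W} {G : SimpleGraph V}

theorem IsHelper.card_cell {h : V × V × Finset V} (hh : T.IsHelper G h) :
    (cell h).card = Fintype.card W := by
  rw [cell, Finset.card_insert_of_notMem hh.notMem, hh.core.card]

theorem IsHelper.tileable {h : V × V × Finset V} (hh : T.IsHelper G h) : T.Tileable G (cell h) :=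
  hh.core.tileable _ hh.notMem hh.adj

theorem IsHelperSystem.card_biUnion {J : Finset (V × V × Finset V)}
    (hJ : T.IsHelperSystem G J) : (J.biUnion cell).card = J.card * Fintype.card W := by
  rw [Finset.card_biUnion hJ.disjoint, Finset.sum_congr rfl fun h hh => (hJ.isHelper h hh).card_cell,
    Finset.sum_const, smul_eq_mul]

variable [Fintype V]

/-- Conditional expectations without probability: an event carries weight `(1 / 2) ^ hits`, and each
new pair is chosen to lie in events of large total weight. Some unused pair lies in events carrying
a `θ / 2` share of the weight, and their weight is halved, so the total drops by the factor `1 - θ /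
4`. -/
theorem IsTree.exists_helperSystem_aux [Nontrivial W] (hT : T.IsTree) {η θ : ℝ} (hθ : 0 < θ)
    (hθ1 : θ ≤ 1) {m : ℕ} (hδ : ∀ v, η * Fintype.card V ≤ (G.nbr v).card)
    (hm : 4 * ((m : ℝ) * Fintype.card W) ≤ θ * Fintype.card V)
    (hα : ((Fintype.card W * G.indepNum + m * Fintype.card W + 1 : ℕ) : ℝ) < η * Fintype.card V)
    (F : Finset (Finset (V × V))) (hF : F.Nonempty) (hadj : ∀ E ∈ F, ∀ p ∈ E, G.Adj p.1 p.2)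
    (hE : ∀ E ∈ F, θ * (Fintype.card V : ℝ) ^ 2 ≤ E.card) (j : ℕ) (hj : j ≤ m) :
    ∃ J, T.IsHelperSystem G J ∧ J.card = j ∧
      ∑ E ∈ F, (1 / 2 : ℝ) ^ hits J E ≤ F.card * (1 - θ / 4) ^ j := by
  induction j with
  | zero => exact ⟨∅, ⟨by simp, by simp⟩, by simp, by simp [hits]⟩
  | succ j ih =>
    obtain ⟨J, hJ, hJc, hsum⟩ := ih (by omega)
    set n : ℝ := (Fintype.card V : ℝ) with hn
    set k := Fintype.card W with hk
    set U := J.biUnion cell with hU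
    have hUc : U.card = j * k := by rw [hU, hJ.card_biUnion, hJc]
    have hn0 : 0 < n := by
      rcases Nat.eq_zero_or_pos (Fintype.card V) with h0 | h0
      · rw [hn, h0] at hα
        have : (0 : ℝ) ≤ ((k * G.indepNum + m * k + 1 : ℕ) : ℝ) := by positivity
        simp only [Nat.cast_zero, mul_zero] at hα
        linarith
      · rw [hn]; exact_mod_cast h0
    have hjm : ((j : ℝ) * k) ≤ m * k := by
      have : (j : ℝ) ≤ m := by exact_mod_cast (Nat.le_of_succ_le hj)
      gcongr
    set A : Finset (V × V) := Finset.univ.filter fun p => p.1 ∉ U ∧ p.2 ∉ U with hA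
    -- Pairs meeting the `j k` used vertices number at most `2 j k n`, which `hm` bounds by half of
    -- `θ n ^ 2`.
    have hEA : ∀ E ∈ F, θ / 2 * n ^ 2 ≤ (E ∩ A).card := by
      intro E hEF
      have h1 : E ⊆ (E ∩ A) ∪ (U ×ˢ Finset.univ ∪ Finset.univ ×ˢ U) := by
        intro p hp
        simp only [hA, Finset.mem_union, Finset.mem_inter, hp, Finset.mem_filter, Finset.mem_univ,
          Finset.mem_product, true_and, and_true]
        tauto
      have h2 : E.card ≤ (E ∩ A).card + (j * k * Fintype.card V + Fintype.card V * (j * k)) := by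
        refine (Finset.card_le_card h1).trans ((Finset.card_union_le _ _).trans ?_)
        gcongr
        refine (Finset.card_union_le _ _).trans ?_
        rw [Finset.card_product, Finset.card_product, hUc, Finset.card_univ]
      have h3 : (E.card : ℝ) ≤ (E ∩ A).card + (j * k * n + n * (j * k)) := by
        rw [hn]; exact_mod_cast h2
      have h4 := hE E hEF
      have h5 : 4 * ((j : ℝ) * k) * n ≤ θ * n * n :=
        mul_le_mul_of_nonneg_right (by linarith) hn0.le
      nlinarith
    have hAne : A.Nonempty := by
      obtain ⟨E, hEF⟩ := hF
      have h1 : 0 < θ / 2 * n ^ 2 := by positivity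
      have h2 : 0 < (E ∩ A).card := by exact_mod_cast h1.trans_le (hEA E hEF)
      exact (Finset.card_pos.1 h2).mono Finset.inter_subset_right
    obtain ⟨⟨x, y⟩, hpA, hp⟩ := exists_mem_mul_sum_le F A (fun E => (1 / 2 : ℝ) ^ hits J E)
      (fun _ _ => by positivity) hAne hEA
    rw [Fintype.card_prod] at hp
    push_cast at hp
    rw [← hn] at hp
    have hp' : θ / 2 * ∑ E ∈ F, (1 / 2 : ℝ) ^ hits J E ≤
        ∑ E ∈ F.filter ((x, y) ∈ ·), (1 / 2 : ℝ) ^ hits J E := by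
      refine le_of_mul_le_mul_left ?_ (show 0 < n ^ 2 by positivity)
      linarith
    have hpos : 0 < ∑ E ∈ F, (1 / 2 : ℝ) ^ hits J E :=
      Finset.sum_pos (fun _ _ => by positivity) hF
    have hxy : G.Adj x y := by
      have h1 : 0 < ∑ E ∈ F.filter ((x, y) ∈ ·), (1 / 2 : ℝ) ^ hits J E :=
        lt_of_lt_of_le (by positivity) hp'
      obtain ⟨E, hE, -⟩ := Finset.exists_ne_zero_of_sum_ne_zero h1.ne'
      rw [Finset.mem_filter] at hE
      exact hadj E hE.1 _ hE.2
    simp only [hA, Finset.mem_filter, Finset.mem_univ, true_and] at hpA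
    -- The core is built away from earlier cells and from `y`, which must remain its completing
    -- vertex.
    obtain ⟨C, hC, hCS⟩ := hT.exists_isCore (G := G) (x := x) (S := (G.nbr x \ U).erase y) (by
      have h1 : (G.nbr x).card ≤ ((G.nbr x \ U).erase y).card + 1 + U.card := by
        have := Finset.le_card_sdiff U (G.nbr x)
        have := Finset.pred_card_le_card_erase (s := G.nbr x \ U) (a := y)
        omega
      have h2 := hα.trans_le (hδ x)
      have h3 : k * G.indepNum + m * k + 1 < (G.nbr x).card := by exact_mod_cast h2
      have h4 : j * k ≤ m * k := Nat.mul_le_mul_right _ (by omega)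
      rw [← hk]
      omega) ((Finset.erase_subset _ _).trans Finset.sdiff_subset)
    have hyC : y ∉ C := fun h => by
      have := hCS h
      simp [hxy.ne'] at this
    have hcell : Disjoint (cell (x, y, C)) U := by
      rw [Finset.disjoint_left]
      intro a ha haU
      simp only [cell, Finset.mem_insert] at ha
      rcases ha with rfl | ha
      · exact hpA.2 haU
      · have := hCS ha
        simp only [Finset.mem_insert, Finset.mem_erase, Finset.mem_sdiff] at this
        rcases this with rfl | h
        · exact hpA.1 haU
        · exact h.2.2 haU
    have hnew : (x, y, C) ∉ J := fun h => hpA.2 (Finset.mem_biUnion.2 ⟨_, h, by simp [cell]⟩)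
    refine ⟨insert (x, y, C) J, ⟨?_, ?_⟩, ?_, ?_⟩
    · intro h hh
      rcases Finset.mem_insert.1 hh with rfl | hh
      · exact ⟨hC, hyC, hxy⟩
      · exact hJ.isHelper h hh
    · rw [Finset.coe_insert, Set.pairwiseDisjoint_insert]
      refine ⟨hJ.disjoint, fun h hh _ => ?_⟩
      exact (Finset.disjoint_biUnion_right _ _ _).1 hcell h hh
    · rw [Finset.card_insert_of_notMem hnew, hJc]
    · have hhit : ∀ E, (1 / 2 : ℝ) ^ hits (insert (x, y, C) J) E =
          (1 / 2 : ℝ) ^ hits J E - if (x, y) ∈ E then (1 / 2) * (1 / 2 : ℝ) ^ hits J E else 0 := by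
        intro E
        rw [hits, hits, Finset.filter_insert]
        split_ifs with h
        · rw [Finset.card_insert_of_notMem (fun h' => hnew (Finset.mem_filter.1 h').1), pow_succ]
          ring
        · ring
      simp_rw [hhit]
      rw [Finset.sum_sub_distrib, ← Finset.sum_filter, ← Finset.mul_sum, pow_succ]
      have h1 : (0 : ℝ) ≤ 1 - θ / 4 := by linarith
      calc _ ≤ (∑ E ∈ F, (1 / 2 : ℝ) ^ hits J E) * (1 - θ / 4) := by linarith
        _ ≤ (F.card * (1 - θ / 4) ^ j) * (1 - θ / 4) := by gcongr
        _ = _ := by ring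

/-- A single weight is at most the final total; taking logarithms, the number of events costs only
`Real.log F.card` hits. -/
theorem IsTree.exists_helperSystem [Nontrivial W] (hT : T.IsTree) {η θ : ℝ} (hθ : 0 < θ)
    (hθ1 : θ ≤ 1) {m : ℕ} (hδ : ∀ v, η * Fintype.card V ≤ (G.nbr v).card)
    (hm : 4 * ((m : ℝ) * Fintype.card W) ≤ θ * Fintype.card V)
    (hα : ((Fintype.card W * G.indepNum + m * Fintype.card W + 1 : ℕ) : ℝ) < η * Fintype.card V)
    (F : Finset (Finset (V × V))) (hadj : ∀ E ∈ F, ∀ p ∈ E, G.Adj p.1 p.2)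
    (hE : ∀ E ∈ F, θ * (Fintype.card V : ℝ) ^ 2 ≤ E.card) :
    ∃ J, T.IsHelperSystem G J ∧
      ∀ E ∈ F, θ * m / 4 ≤ hits J E + Real.log F.card := by
  rcases F.eq_empty_or_nonempty with rfl | hF
  · exact ⟨∅, ⟨by simp, by simp⟩, by simp⟩
  obtain ⟨J, hJ, -, hsum⟩ := hT.exists_helperSystem_aux hθ hθ1 hδ hm hα F hF hadj hE m le_rfl
  refine ⟨J, hJ, fun E hEF => ?_⟩
  have hF0 : (0 : ℝ) < F.card := by exact_mod_cast hF.card_pos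
  have h1 : (1 / 2 : ℝ) ^ hits J E ≤ F.card * (1 - θ / 4) ^ m :=
    (Finset.single_le_sum (f := fun E => (1 / 2 : ℝ) ^ hits J E)
      (fun _ _ => by positivity) hEF).trans hsum
  have h2 : (0 : ℝ) < 1 - θ / 4 := by linarith
  have h3 := Real.log_le_log (by positivity) h1
  rw [Real.log_pow, Real.log_mul hF0.ne' (by positivity), Real.log_pow, one_div, Real.log_inv] at h3
  have h4 : Real.log (1 - θ / 4) ≤ -(θ / 4) := by
    have := Real.log_le_sub_one_of_pos h2
    linarith
  have h5 : (m : ℝ) * Real.log (1 - θ / 4) ≤ m * -(θ / 4) := by gcongr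
  have h6 : Real.log 2 ≤ 1 := by
    have := Real.log_le_sub_one_of_pos (show (0 : ℝ) < 2 by norm_num)
    linarith
  have h7 : (hits J E : ℝ) * Real.log 2 ≤ hits J E * 1 := by gcongr
  linarith

end Helpers

/-! ### Moving holes through helpers and absorbing leftover vertices. -/

section Absorption

open scoped Classical

variable {V W : Type*} [Fintype W] {T : SimpleGraph W} {G : SimpleGraph V}

theorem IsHelperSystem.subset {J J' : Finset (V × V × Finset V)} (hJ : T.IsHelperSystem G J)
    (h : J' ⊆ J) : T.IsHelperSystem G J' :=
  ⟨fun a ha => hJ.isHelper a (h ha), hJ.disjoint.subset (by simpa using h)⟩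

theorem IsHelperSystem.eq_of_mem_cell {J : Finset (V × V × Finset V)} (hJ : T.IsHelperSystem G J)
    {a b : V × V × Finset V} (ha : a ∈ J) (hb : b ∈ J) {v : V} (hva : v ∈ cell a)
    (hvb : v ∈ cell b) : a = b := by
  by_contra hne
  exact Finset.disjoint_left.1 (hJ.disjoint ha hb hne) hva hvb

theorem mem_cell_self (h : V × V × Finset V) : h.2.1 ∈ cell h := Finset.mem_insert_self _ _

theorem mem_cell_of_mem {h : V × V × Finset V} {v : V} (hv : v ∈ h.2.2) : v ∈ cell h :=
  Finset.mem_insert_of_mem hv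

/-- Spent helpers cost each event at most their number, so the system stays usable through many
absorptions. -/
theorem hits_le_hits_add {J J' : Finset (V × V × Finset V)} (E : Finset (V × V)) :
    hits J E ≤ hits J' E + (J \ J').card := by
  refine le_trans (Finset.card_le_card ?_) (Finset.card_union_le _ _)
  intro h hh
  simp only [Finset.mem_filter, Finset.mem_union, Finset.mem_sdiff] at hh ⊢
  tauto

variable [Fintype V]

/-- A vertex `u` from which the neighbourhood of the first vertex of the helper `t` is reached can be
absorbed so that, of the helpers involved, only the completing vertex of `t` is set free. -/
theorem IsHelperSystem.absorb_vertex {J : Finset (V × V × Finset V)} (hJ : T.IsHelperSystem G J)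
    {θ : ℝ} {L d : ℕ} {t : V × V × Finset V} (ht : t ∈ J)
    (hhit : ∀ l < L, ∀ v, θ * (Fintype.card V : ℝ) ^ 2 ≤
      (G.walks v (G.reach θ l (G.nbr t.1))).card →
      d ≤ hits J (G.walks v (G.reach θ l (G.nbr t.1)))) (l : ℕ) (hl : l ≤ L) :
    ∀ (u : V) (X : Finset (V × V × Finset V)), u ∈ G.reach θ l (G.nbr t.1) → t ∈ X →
      X.card + l ≤ d → u ∉ t.2.2 → (∀ h ∈ J, h ∉ X → u ∉ cell h) →
      ∃ R ⊆ J \ X, R.card ≤ l ∧ T.Tileable G (insert u (R.biUnion cell ∪ t.2.2)) := by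
  induction l with
  | zero =>
    intro u X hu _ _ hut _
    refine ⟨∅, by simp, by simp, ?_⟩
    simpa using (hJ.isHelper t ht).core.tileable u hut (by simpa [reach] using hu)
  | succ l ih =>
    intro u X hu htX hXd hut hcell
    rcases mem_reach_succ.1 hu with hu | hu
    · obtain ⟨R, h1, h2, h3⟩ := ih (by omega) u X hu htX (by omega) hut hcell
      exact ⟨R, h1, by omega, h3⟩
    have hlt : X.card < (J.filter fun h =>
        (h.1, h.2.1) ∈ G.walks u (G.reach θ l (G.nbr t.1))).card := by
      have := hhit l (by omega) u hu
      rw [hits] at this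
      omega
    obtain ⟨h, hh, hhX⟩ := Finset.exists_mem_notMem_of_card_lt_card hlt
    simp only [walks, Finset.mem_filter, Finset.mem_univ, true_and] at hh
    obtain ⟨hhJ, hadj, -, hreach⟩ := hh
    have hht : h ≠ t := fun e => hhX (e ▸ htX)
    have huh := hcell h hhJ hhX
    -- The vertex `u` replaces the completing vertex of `h`, which becomes the new hole, one double
    -- step closer to the target.
    obtain ⟨R, hR, hRc, hRt⟩ := ih (by omega) h.2.1 (insert h X) hreach (by simp [htX])
      (by rw [Finset.card_insert_of_notMem hhX]; omega)
      (fun hm => hht (hJ.eq_of_mem_cell hhJ ht (mem_cell_self h) (mem_cell_of_mem hm)))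
      (fun h' hh' hX hm => hX (by
        rw [hJ.eq_of_mem_cell hh' hhJ hm (mem_cell_self h)]; simp))
    have hRJ : ∀ r ∈ R, r ∈ J ∧ r ≠ h ∧ r ∉ X := by
      intro r hr
      have := hR hr
      simpa only [Finset.mem_sdiff, Finset.mem_insert, not_or] using this
    refine ⟨insert h R, ?_, ?_, ?_⟩
    · intro r hr
      rcases Finset.mem_insert.1 hr with rfl | hr
      · exact Finset.mem_sdiff.2 ⟨hhJ, hhX⟩
      · exact Finset.mem_sdiff.2 ⟨(hRJ r hr).1, (hRJ r hr).2.2⟩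
    · exact (Finset.card_insert_le _ _).trans (by omega)
    · have hA := (hJ.isHelper h hhJ).core.tileable u (fun hm => huh (mem_cell_of_mem hm)) hadj.symm
      have := hA.union hRt (by
        rw [Finset.disjoint_left]
        intro a ha hb
        simp only [Finset.mem_insert, Finset.mem_union, Finset.mem_biUnion] at ha hb
        rcases ha with rfl | ha
        · rcases hb with rfl | ⟨r, hr, hb⟩ | hb
          · exact huh (mem_cell_self h)
          · exact hcell r (hRJ r hr).1 (hRJ r hr).2.2 hb
          · exact hut hb
        · rcases hb with rfl | ⟨r, hr, hb⟩ | hb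
          · exact (hJ.isHelper h hhJ).notMem ha
          · exact (hRJ r hr).2.1 (hJ.eq_of_mem_cell (hRJ r hr).1 hhJ hb (mem_cell_of_mem ha))
          · exact hht (hJ.eq_of_mem_cell hhJ ht (mem_cell_of_mem ha) (mem_cell_of_mem hb)))
      convert this using 1
      ext a
      simp only [Finset.mem_insert, Finset.mem_union, Finset.mem_biUnion, cell]
      constructor
      · rintro (h1 | ⟨r, rfl | hr, h1⟩ | h1) <;> grind
      · rintro ((h1 | h1) | (h1 | ⟨r, hr, h1⟩ | h1)) <;> grind

/-- The chains are built one after another, each avoiding all targets and all helpers spent so far;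
there are at most `card ι * (L + 1)` of these, which explains `hd`. -/
theorem IsHelperSystem.absorb_finset {J : Finset (V × V × Finset V)} (hJ : T.IsHelperSystem G J)
    {θ : ℝ} {L d : ℕ} (hhit : ∀ z, ∀ l < L, ∀ v, θ * (Fintype.card V : ℝ) ^ 2 ≤
      (G.walks v (G.reach θ l (G.nbr z))).card → d ≤ hits J (G.walks v (G.reach θ l (G.nbr z))))
    {ι : Type*} [Fintype ι] {t : ι → V × V × Finset V} (ht : ∀ a, t a ∈ J)
    (htinj : Function.Injective t) {u : ι → V} (huinj : Function.Injective u)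
    (hu : ∀ a, u a ∈ G.reach θ L (G.nbr (t a).1)) (hcell : ∀ a, ∀ h ∈ J, u a ∉ cell h)
    (hd : Fintype.card ι * (L + 1) ≤ d) (A : Finset ι) :
    ∃ R ⊆ J \ Finset.univ.image t, R.card ≤ A.card * L ∧
      T.Tileable G (A.image u ∪ R.biUnion cell ∪ A.biUnion fun a => (t a).2.2) := by
  induction A using Finset.induction_on with
  | empty => exact ⟨∅, by simp, by simp, by simpa using tileable_empty T G⟩
  | insert a A haA ih =>
    obtain ⟨R, hR, hRc, hRt⟩ := ih
    have hAc : A.card + 1 ≤ Fintype.card ι := by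
      rw [← Finset.card_insert_of_notMem haA]; exact Finset.card_le_univ _
    have hXc : (Finset.univ.image t ∪ R).card + L ≤ d := by
      have h1 := Finset.card_union_le (Finset.univ.image t) R
      rw [Finset.card_image_of_injective _ htinj, Finset.card_univ] at h1
      have h2 : (A.card + 1) * L ≤ Fintype.card ι * L := Nat.mul_le_mul_right _ hAc
      nlinarith
    obtain ⟨R', hR', hRc', hRt'⟩ := hJ.absorb_vertex (ht a) (hhit (t a).1) L le_rfl (u a)
      (Finset.univ.image t ∪ R) (hu a) (by simp) hXc
      (fun hm => hcell a (t a) (ht a) (mem_cell_of_mem hm)) (fun h hh _ => hcell a h hh)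
    have hRJ : ∀ r ∈ R, r ∈ J ∧ ∀ b, t b ≠ r := by
      intro r hr
      have := hR hr
      simpa using this
    have hRJ' : ∀ r ∈ R', r ∈ J ∧ (∀ b, t b ≠ r) ∧ r ∉ R := by
      intro r hr
      have := hR' hr
      simpa using this
    refine ⟨R ∪ R', ?_, ?_, ?_⟩
    · intro r hr
      rcases Finset.mem_union.1 hr with hr | hr
      · exact hR hr
      · have := hRJ' r hr
        simpa using And.intro this.1 this.2.1
    · rw [Finset.card_insert_of_notMem haA, Nat.succ_mul]
      exact (Finset.card_union_le _ _).trans (by omega)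
    · have := hRt.union hRt' (by
        rw [Finset.disjoint_left]
        intro x hx hy
        simp only [Finset.mem_insert, Finset.mem_union, Finset.mem_biUnion, Finset.mem_image]
          at hx hy
        rcases hx with (⟨b, hb, rfl⟩ | ⟨r, hr, hx⟩) | ⟨b, hb, hx⟩
        · rcases hy with hy | ⟨r, hr, hy⟩ | hy
          · exact haA (huinj hy ▸ hb)
          · exact hcell b r (hRJ' r hr).1 hy
          · exact hcell b _ (ht a) (mem_cell_of_mem hy)
        · rcases hy with rfl | ⟨s, hs, hy⟩ | hy
          · exact hcell a r (hRJ r hr).1 hx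
          · exact (hRJ' s hs).2.2 (hJ.eq_of_mem_cell (hRJ r hr).1 (hRJ' s hs).1 hx hy ▸ hr)
          · exact (hRJ r hr).2 a (hJ.eq_of_mem_cell (ht a) (hRJ r hr).1 (mem_cell_of_mem hy) hx)
        · rcases hy with rfl | ⟨s, hs, hy⟩ | hy
          · exact hcell a _ (ht b) (mem_cell_of_mem hx)
          · exact (hRJ' s hs).2.1 b
              (hJ.eq_of_mem_cell (ht b) (hRJ' s hs).1 (mem_cell_of_mem hx) hy)
          · exact haA (htinj (hJ.eq_of_mem_cell (ht b) (ht a) (mem_cell_of_mem hx)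
              (mem_cell_of_mem hy)) ▸ hb))
      convert this using 1
      ext x
      simp only [Finset.mem_insert, Finset.mem_union, Finset.mem_biUnion, Finset.mem_image]
      constructor
      · rintro ((⟨b, rfl | hb, rfl⟩ | ⟨r, hr | hr, hx⟩) | ⟨b, rfl | hb, hx⟩) <;> grind
      · rintro (((⟨b, hb, rfl⟩ | ⟨r, hr, hx⟩) | ⟨b, hb, hx⟩) | (rfl | ⟨r, hr, hx⟩ | hx)) <;> grind

theorem IsHelperSystem.absorb_group {J : Finset (V × V × Finset V)} (hJ : T.IsHelperSystem G J)
    (hT : T.IsTree) {θ : ℝ} {L d : ℕ} (hhit : ∀ z, ∀ l < L, ∀ v,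
      θ * (Fintype.card V : ℝ) ^ 2 ≤ (G.walks v (G.reach θ l (G.nbr z))).card →
      d ≤ hits J (G.walks v (G.reach θ l (G.nbr z)))) {Z : Finset V}
    (hZ : d ≤ hits J (Finset.univ.filter fun p : V × V => p.1 ∈ Z ∧ G.Adj p.1 p.2))
    {U : Finset V} (hUc : U.card = Fintype.card W)
    (hU : ∀ u ∈ U, ∀ z ∈ Z, u ∈ G.reach θ L (G.nbr z)) (hcell : Disjoint U (J.biUnion cell))
    (hd : Fintype.card W * (L + 1) ≤ d) (hα : Fintype.card W * G.indepNum < d) :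
    ∃ P ⊆ J, P.card ≤ Fintype.card W * (L + 1) ∧ T.Tileable G (U ∪ P.biUnion cell) := by
  set Jt := J.filter fun h => (h.1, h.2.1) ∈
    Finset.univ.filter fun p : V × V => p.1 ∈ Z ∧ G.Adj p.1 p.2 with hJt
  have hJtJ : ∀ h ∈ Jt, h ∈ J := fun h hh => (Finset.mem_filter.1 hh).1
  -- The targets are chosen so that their completing vertices, the ones set free at the end, span a
  -- copy of the tree.
  obtain ⟨f, hf⟩ := hT.exists_copy_of_indepNum_lt (G := G) (S := Jt.image fun h => h.2.1) (by
    rw [Finset.card_image_of_injOn]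
    · exact hα.trans_le hZ
    · intro a ha b hb hab
      refine hJ.eq_of_mem_cell (hJtJ a ha) (hJtJ b hb) (mem_cell_self a) ?_
      rw [show a.2.1 = b.2.1 from hab]
      exact mem_cell_self b)
  have hf' : ∀ w, ∃ h ∈ Jt, h.2.1 = f w := fun w => by simpa only [Finset.mem_image] using hf w
  choose t htJt htf using hf'
  have ht : ∀ w, t w ∈ J := fun w => hJtJ _ (htJt w)
  have htinj : Function.Injective t := fun a b hab => f.injective (by
    change f a = f b
    rw [← htf, ← htf, hab])
  -- Any matching of leftover vertices with targets works, since each `u ∈ U` reaches the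
  -- neighbourhood of each `z ∈ Z`.
  have e : W ≃ U := Fintype.equivOfCardEq (by simp [hUc])
  have hcell' : ∀ w, ∀ h ∈ J, (e w : V) ∉ cell h := fun w h hh hm =>
    Finset.disjoint_left.1 hcell (e w).2 (Finset.mem_biUnion.2 ⟨h, hh, hm⟩)
  obtain ⟨R, hR, hRc, hRt⟩ := hJ.absorb_finset hhit ht htinj (u := fun w => (e w : V))
    (Subtype.val_injective.comp e.injective)
    (fun w => hU _ (e w).2 _ (by
      have := htJt w
      simp only [hJt, Finset.mem_filter, Finset.mem_univ, true_and] at this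
      exact this.2.1)) hcell' hd Finset.univ
  have hRJ : ∀ r ∈ R, r ∈ J ∧ ∀ b, t b ≠ r := by
    intro r hr
    have := hR hr
    simpa using this
  refine ⟨R ∪ Finset.univ.image t, ?_, ?_, ?_⟩
  · intro r hr
    rcases Finset.mem_union.1 hr with hr | hr
    · exact (hRJ r hr).1
    · obtain ⟨w, -, rfl⟩ := Finset.mem_image.1 hr
      exact ht w
  · refine (Finset.card_union_le _ _).trans ?_
    rw [Finset.card_image_of_injective _ htinj, Finset.card_univ, Nat.mul_succ]
    rw [Finset.card_univ] at hRc
    omega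
  · have := hRt.union (tileable_image f) (by
      rw [Finset.disjoint_left]
      intro x hx hy
      simp only [Finset.mem_union, Finset.mem_biUnion, Finset.mem_image, Finset.mem_univ,
        true_and] at hx hy
      obtain ⟨w, rfl⟩ := hy
      have hw : f w ∈ cell (t w) := htf w ▸ mem_cell_self _
      rcases hx with (⟨b, hb⟩ | ⟨r, hr, hx⟩) | ⟨b, hx⟩
      · exact hcell' b _ (ht w) (hb ▸ hw)
      · exact (hRJ r hr).2 w (hJ.eq_of_mem_cell (ht w) (hRJ r hr).1 hw hx)
      · have := hJ.eq_of_mem_cell (ht w) (ht b) hw (mem_cell_of_mem hx)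
        rw [← this, ← htf] at hx
        exact (hJ.isHelper _ (ht w)).notMem hx)
    convert this using 1
    ext x
    simp only [Finset.mem_union, Finset.mem_biUnion, Finset.mem_image, Finset.mem_univ, true_and,
      cell, Finset.mem_insert]
    constructor
    · rintro (hx | ⟨r, hr | ⟨w, rfl⟩, hx⟩)
      · exact .inl (.inl (.inl ⟨e.symm ⟨x, hx⟩, by simp⟩))
      · exact .inl (.inl (.inr ⟨r, hr, hx⟩))
      · rcases hx with rfl | hx
        · exact .inr ⟨w, (htf w).symm⟩
        · exact .inl (.inr ⟨w, hx⟩)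
    · rintro (((⟨w, rfl⟩ | ⟨r, hr, hx⟩) | ⟨w, hx⟩) | ⟨w, rfl⟩)
      · exact .inl (e w).2
      · exact .inr ⟨r, .inl hr, hx⟩
      · exact .inr ⟨t w, .inr ⟨w, rfl⟩, .inr hx⟩
      · exact .inr ⟨t w, .inr ⟨w, rfl⟩, .inl (htf w).symm⟩

/-- If every event needed for absorption is hit often enough by a helper system, the helpers can be
completed to a tiling that leaves out at most `k - 1` vertices of each class. -/
theorem IsHelperSystem.exists_tiling {J : Finset (V × V × Finset V)} (hJ : T.IsHelperSystem G J)
    (hT : T.IsTree) {θ : ℝ} {L d c : ℕ} {cls : V → V} {Z : V → Finset V}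
    (hcls : (Finset.univ.image cls).card ≤ c)
    (hZr : ∀ u, ∀ z ∈ Z (cls u), u ∈ G.reach θ L (G.nbr z))
    (hhit : ∀ z, ∀ l < L, ∀ v,
      θ * (Fintype.card V : ℝ) ^ 2 ≤ (G.walks v (G.reach θ l (G.nbr z))).card →
      d ≤ hits J (G.walks v (G.reach θ l (G.nbr z))))
    (hZ : ∀ u, d ≤ hits J (Finset.univ.filter fun p : V × V => p.1 ∈ Z (cls u) ∧ G.Adj p.1 p.2))
    (hd : (L + 1) * (Fintype.card W * G.indepNum) + Fintype.card W * (L + 1) +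
      Fintype.card W * G.indepNum < d) :
    ∃ M : Set (Copy T G), T.IsTiling G M ∧ (uncovered M).ncard ≤ c * (Fintype.card W - 1) := by
  set k := Fintype.card W with hk
  have hk0 : 0 < k := by
    have := hT.1.nonempty
    exact Fintype.card_pos
  -- `Q` is tiled for good, `J'` holds the unspent helpers and `N` counts the leftover vertices. A
  -- round removes `k` of these at the price of at most `k (L + 1)` helpers, which preserves the
  -- budget inequality.
  have key : ∀ (N : ℕ) (J' : Finset (V × V × Finset V)) (Q : Finset V), J' ⊆ J → T.Tileable G Q →
      Disjoint Q (J'.biUnion cell) → (Finset.univ \ (Q ∪ J'.biUnion cell)).card = N →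
      (J \ J').card + (L + 1) * N ≤ (L + 1) * (k * G.indepNum) →
      ∃ M : Set (Copy T G), T.IsTiling G M ∧ (uncovered M).ncard ≤ c * (k - 1) := by
    intro N
    induction N using Nat.strong_induction_on with
    | _ N ih =>
    intro J' Q hJ'J hQ hdisj hN hbudget
    have hJ' := hJ.subset hJ'J
    set S := Finset.univ \ (Q ∪ J'.biUnion cell) with hS
    rcases le_or_gt N (c * (k - 1)) with hsmall | hlarge
    · obtain ⟨M, hM, hMv⟩ := hQ.union
        (Tileable.biUnion (fun h hh => (hJ'.isHelper h hh).tileable) hJ'.disjoint) hdisj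
      refine ⟨M, hM, ?_⟩
      have : uncovered M = (S : Set V) := by
        ext v
        rw [Finset.mem_coe, hS, Finset.mem_sdiff, hMv]
        simp [uncovered]
      rw [this, Set.ncard_coe_finset, hN]
      exact hsmall
    · obtain ⟨v, hv, hfib⟩ := Finset.exists_lt_card_fiber_of_mul_lt_card_of_maps_to
        (s := S) (t := Finset.univ.image cls) (f := cls) (n := k - 1) (fun a _ => by simp) (by
          rw [hN]
          exact (Nat.mul_le_mul_right _ hcls).trans_lt hlarge)
      obtain ⟨U, hUS, hUc⟩ := Finset.exists_subset_card_eq 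
        (show k ≤ (S.filter fun x => cls x = v).card by omega)
      obtain ⟨u₀, -, rfl⟩ := Finset.mem_image.1 hv
      have hU : ∀ u ∈ U, u ∈ S ∧ cls u = cls u₀ := fun u hu => by simpa using hUS hu
      have hJJ : (J \ J').card ≤ (L + 1) * (k * G.indepNum) := by omega
      obtain ⟨P, hPJ, hPc, hPt⟩ := hJ'.absorb_group hT
        (d := d - (L + 1) * (k * G.indepNum)) (fun z l hl v hv => by
          have h1 := hhit z l hl v hv
          have h2 := hits_le_hits_add (J := J) (J' := J') (G.walks v (G.reach θ l (G.nbr z)))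
          omega) (Z := Z (cls u₀)) (by
          have h1 := hZ u₀
          have h2 := hits_le_hits_add (J := J) (J' := J')
            (Finset.univ.filter fun p : V × V => p.1 ∈ Z (cls u₀) ∧ G.Adj p.1 p.2)
          omega) hUc (fun u hu z hz => hZr u z (by rwa [(hU u hu).2])) (by
          rw [Finset.disjoint_left]
          intro u hu hm
          have := (hU u hu).1
          simp only [hS, Finset.mem_sdiff, Finset.mem_union, not_or] at this
          exact this.2.2 hm) (by rw [← hk]; omega) (by rw [← hk]; omega)
      rw [← hk] at hPc
      have hsplit : ∀ x, x ∈ J'.biUnion cell ↔ x ∈ P.biUnion cell ∨ x ∈ (J' \ P).biUnion cell := by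
        intro x
        rw [← Finset.mem_union, ← Finset.union_biUnion, Finset.union_sdiff_of_subset hPJ]
      have hQU : ∀ x ∈ U, x ∉ Q ∧ x ∉ J'.biUnion cell := by
        intro x hx
        have := (hU x hx).1
        simpa only [hS, Finset.mem_sdiff, Finset.mem_univ, true_and, Finset.mem_union, not_or]
          using this
      have hUsub : U ⊆ S := fun u hu => (hU u hu).1
      have hnew : Finset.univ \ (Q ∪ (U ∪ P.biUnion cell) ∪ (J' \ P).biUnion cell) = S \ U := by
        ext x
        have := hsplit x
        simp only [hS, Finset.mem_sdiff, Finset.mem_union, Finset.mem_univ, true_and]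
        tauto
      have hkN : k ≤ N := by rw [← hUc, ← hN]; exact Finset.card_le_card hUsub
      refine ih (N - k) (by omega) (J' \ P) (Q ∪ (U ∪ P.biUnion cell))
        (Finset.sdiff_subset.trans hJ'J) (hQ.union hPt ?_) ?_ ?_ ?_
      · rw [Finset.disjoint_left]
        intro x hx hy
        rcases Finset.mem_union.1 hy with hy | hy
        · exact (hQU x hy).1 hx
        · exact Finset.disjoint_left.1 hdisj hx ((hsplit x).2 (.inl hy))
      · rw [Finset.disjoint_left]
        intro x hx hy
        have hx' := (hsplit x).2 (.inr hy)
        rcases Finset.mem_union.1 hx with hx | hx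
        · exact Finset.disjoint_left.1 hdisj hx hx'
        rcases Finset.mem_union.1 hx with hx | hx
        · exact (hQU x hx).2 hx'
        · obtain ⟨a, ha, hxa⟩ := Finset.mem_biUnion.1 hx
          obtain ⟨b, hb, hxb⟩ := Finset.mem_biUnion.1 hy
          rw [Finset.mem_sdiff] at hb
          exact hb.2 (hJ'.eq_of_mem_cell (hPJ ha) hb.1 hxa hxb ▸ ha)
      · rw [hnew, Finset.card_sdiff_of_subset hUsub, hN, hUc]
      · have h1 : (J \ (J' \ P)).card ≤ (J \ J').card + P.card := by
          refine le_trans (Finset.card_le_card ?_) (Finset.card_union_le _ _)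
          intro x hx
          simp only [Finset.mem_sdiff, Finset.mem_union] at hx ⊢
          tauto
        have h2 : (L + 1) * N = (L + 1) * (N - k) + k * (L + 1) := by
          rw [mul_comm k, ← mul_add, Nat.sub_add_cancel hkN]
        omega
  -- A largest tileable set off the helpers leaves at most `k * G.indepNum` vertices, the initial
  -- value of the budget.
  have hex : ∃ Q : Finset V, (T.Tileable G Q ∧ Disjoint Q (J.biUnion cell)) ∧
      ∀ Q', T.Tileable G Q' ∧ Disjoint Q' (J.biUnion cell) → Q'.card ≤ Q.card := by
    obtain ⟨Q, hQ, hmax⟩ := Finset.exists_max_image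
      (Finset.univ.filter fun Q => T.Tileable G Q ∧ Disjoint Q (J.biUnion cell)) Finset.card
      ⟨∅, by simp [tileable_empty]⟩
    exact ⟨Q, by simpa using hQ, fun Q' hQ' => hmax Q' (by simpa using hQ')⟩
  obtain ⟨Q, ⟨hQ, hQd⟩, hmax⟩ := hex
  refine key _ J Q subset_rfl hQ hQd rfl ?_
  rw [Finset.sdiff_self, Finset.card_empty, zero_add]
  refine Nat.mul_le_mul_left _ ?_
  by_contra! hlt
  obtain ⟨f, hf⟩ := hT.exists_copy_of_indepNum_lt hlt
  have hf' : ∀ w, f w ∉ Q ∧ f w ∉ J.biUnion cell := fun w => by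
    have := hf w
    simpa only [Finset.mem_sdiff, Finset.mem_univ, true_and, Finset.mem_union, not_or] using this
  have hdis : Disjoint Q (Finset.univ.image f) := by
    rw [Finset.disjoint_left]
    intro x hx hy
    obtain ⟨w, -, rfl⟩ := Finset.mem_image.1 hy
    exact (hf' w).1 hx
  have := hmax (Q ∪ Finset.univ.image f) ⟨hQ.union (tileable_image f) hdis, by
    rw [Finset.disjoint_union_left]
    refine ⟨hQd, ?_⟩
    rw [Finset.disjoint_left]
    intro x hx
    obtain ⟨w, -, rfl⟩ := Finset.mem_image.1 hx
    exact (hf' w).2⟩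
  rw [Finset.card_union_of_disjoint hdis, Finset.card_image_of_injective _
    (show Function.Injective f from f.injective), Finset.card_univ] at this
  omega

end Absorption

/-! ### Choice of constants and conclusion. -/

section Assembly

open scoped Classical

theorem eventually_log_add_le (a b : ℝ) {κ : ℝ} (hκ : 0 < κ) :
    ∀ᶠ n : ℕ in atTop, Real.log (a * (n : ℝ) ^ 2) + b ≤ κ * n := by
  have h1 : ∀ᶠ n : ℕ in atTop, ‖Real.log (n : ℝ)‖ ≤ κ / 4 * ‖(n : ℝ)‖ :=
    tendsto_natCast_atTop_atTop.eventually (Real.isLittleO_log_id_atTop.def (by positivity))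
  have h2 : ∀ᶠ n : ℕ in atTop, (|Real.log a| + |b|) / (κ / 2) ≤ (n : ℝ) :=
    tendsto_natCast_atTop_atTop.eventually_ge_atTop _
  filter_upwards [h1, h2, eventually_gt_atTop 0] with n h1 h2 h3
  have h3' : (0 : ℝ) < n := by exact_mod_cast h3
  rw [div_le_iff₀ (by positivity)] at h2
  rw [Real.norm_eq_abs, Real.norm_eq_abs, abs_of_pos h3'] at h1
  have h4 := le_abs_self (Real.log n)
  have h5 := le_abs_self (Real.log a)
  have h6 := le_abs_self b
  have h7 := abs_nonneg (Real.log a)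
  rcases eq_or_ne a 0 with rfl | ha
  · simp only [zero_mul, Real.log_zero]
    nlinarith
  · rw [Real.log_mul ha (by positivity), Real.log_pow]
    push_cast
    linarith

/-- With `m` about `ε n` helpers, each event is hit about `θ ε n / 4 = 2 κ n` times, up to a
logarithm; `κ n` hits suffice once `α` is small compared with `κ`. -/
theorem exists_quasiperfect_tiling {k : ℕ} (hk : 3 ≤ k) {η : ℝ} (hη : 0 < η) (hη1 : η ≤ 1) :
    ∃ α : ℝ, 0 < α ∧ ∀ᶠ n : ℕ in atTop, ∀ (V : Type*) [Fintype V] (G : SimpleGraph V),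
      Fintype.card V = n → (∀ v, η * n ≤ (G.nbr v).card) → (G.indepNum : ℝ) ≤ α * n →
        ∀ (W : Type*) [Fintype W] (T : SimpleGraph W), Fintype.card W = k → T.IsTree →
          ∃ M : Set (Copy T G), T.IsQuasiperfectTiling G η M := by
  obtain ⟨θ₀, hθ₀, L, hclusters⟩ := exists_clusters hη hη1
  have hk0 : (0 : ℝ) < k := by exact_mod_cast (by omega : 0 < k)
  set θ := min (θ₀ * η) η with hθdef
  have hθ : 0 < θ := by positivity
  have hθη : θ ≤ η := min_le_right _ _
  have hθθ : θ ≤ θ₀ * η := min_le_left _ _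
  set ε := θ / (4 * k) with hε
  have hε0 : 0 < ε := by positivity
  set κ := θ * ε / 8 with hκ
  have hκ0 : 0 < κ := by positivity
  set α := min (η / (4 * k)) (κ / (2 * (k * (L + 2)))) with hα
  refine ⟨α, by positivity, ?_⟩
  filter_upwards [eventually_log_add_le (L + 1 : ℝ) (θ / 4) hκ0,
    tendsto_natCast_atTop_atTop.eventually_gt_atTop (2 / η),
    tendsto_natCast_atTop_atTop.eventually_gt_atTop (2 * (k * (L + 1) + 1) / κ)]
    with n hlog hn1 hn2 V _ G hV hδ hind W _ T hW hT
  rw [div_lt_iff₀ (by positivity)] at hn1 hn2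
  have hn0 : (0 : ℝ) < n := by
    rcases (Nat.cast_nonneg n : (0 : ℝ) ≤ n).eq_or_lt with h | h
    · rw [← h] at hn1; simp at hn1; linarith
    · exact h
  have : Nontrivial W := Fintype.one_lt_card_iff_nontrivial.1 (by omega)
  have hα1 : k * (α * n) ≤ η * n / 4 := by
    have h1 : α ≤ η / (4 * k) := min_le_left _ _
    rw [le_div_iff₀ (by positivity)] at h1
    have := mul_le_mul_of_nonneg_right h1 hn0.le
    linarith
  have hα2 : (L + 2) * (k * (α * n)) ≤ κ * n / 2 := by
    have h1 : α ≤ κ / (2 * (k * (L + 2))) := min_le_right _ _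
    rw [le_div_iff₀ (by positivity)] at h1
    have := mul_le_mul_of_nonneg_right h1 hn0.le
    linarith
  have hkind : (k : ℝ) * G.indepNum ≤ k * (α * n) := by gcongr
  set m := ⌊ε * n⌋₊ with hm
  have hm1 : (m : ℝ) ≤ ε * n := Nat.floor_le (by positivity)
  have hm2 : ε * n < m + 1 := Nat.lt_floor_add_one _
  have hmk : (m : ℝ) * k ≤ θ * n / 4 := by
    calc (m : ℝ) * k ≤ ε * n * k := by gcongr
      _ = θ * n / 4 := by rw [hε]; field_simp
  have hθn : θ * n ≤ η * n := by gcongr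
  obtain ⟨cls, Z, hcls, hZ⟩ := hclusters (G := G) (by rwa [hV])
  set ev : V × ℕ × V → Finset (V × V) := fun q => G.walks q.2.2 (G.reach θ₀ q.2.1 (G.nbr q.1))
    with hev
  set evZ : V → Finset (V × V) := fun u =>
    Finset.univ.filter fun p : V × V => p.1 ∈ Z (cls u) ∧ G.Adj p.1 p.2 with hevZ
  -- The events are all robust double steps towards a neighbourhood, and, for each class, the pairs
  -- whose first vertex is a target.
  set F : Finset (Finset (V × V)) :=
    ((Finset.univ ×ˢ Finset.range L ×ˢ Finset.univ).image ev).filter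
      (fun E => θ₀ * (Fintype.card V : ℝ) ^ 2 ≤ E.card) ∪ Finset.univ.image evZ with hF
  have hFcard : Real.log F.card ≤ Real.log ((L + 1) * (n : ℝ) ^ 2) := by
    have hn1' : 1 ≤ n := by exact_mod_cast hn0
    have h1 : F.card ≤ (L + 1) * n ^ 2 := by
      calc F.card ≤ n * (L * n) + n := by
            refine (Finset.card_union_le _ _).trans ?_
            gcongr
            · refine (Finset.card_filter_le _ _).trans (Finset.card_image_le.trans ?_)
              simp [Finset.card_product, hV]
            · refine Finset.card_image_le.trans ?_
              simp [hV]
        _ ≤ (L + 1) * n ^ 2 := by nlinarith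
    have h2 : (F.card : ℝ) ≤ (L + 1) * (n : ℝ) ^ 2 := by exact_mod_cast h1
    -- As `Real.log 0 = 0`, an empty `F` needs the right-hand side to be nonnegative.
    rcases Nat.eq_zero_or_pos F.card with h | h
    · rw [h, Nat.cast_zero, Real.log_zero]
      refine Real.log_nonneg ?_
      exact_mod_cast Nat.one_le_iff_ne_zero.2 (by positivity)
    · exact Real.log_le_log (by exact_mod_cast h) h2
  have hevZcard : ∀ u, θ₀ * η * (n : ℝ) ^ 2 ≤ (evZ u).card := by
    intro u
    have h1 : (evZ u).card = ∑ z ∈ Z (cls u), (G.nbr z).card := by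
      rw [← Finset.card_sigma]
      refine Finset.card_bij' (fun p _ => ⟨p.1, p.2⟩) (fun p _ => (p.1, p.2)) ?_ ?_ ?_ ?_ <;>
        simp [hevZ]
    have h2 := Finset.card_nsmul_le_sum (Z (cls u)) (fun z => ((G.nbr z).card : ℝ)) (η * n)
      (fun z _ => hδ z)
    rw [nsmul_eq_mul] at h2
    rw [h1]
    push_cast
    refine le_trans ?_ h2
    have h3 := (hZ u).1
    rw [hV] at h3
    calc θ₀ * η * (n : ℝ) ^ 2 = θ₀ * n * (η * n) := by ring
      _ ≤ _ := by gcongr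
  obtain ⟨J, hJ, hhits⟩ := hT.exists_helperSystem (G := G) (η := η) hθ (hθη.trans hη1) (m := m)
    (by rwa [hV]) (by rw [hV, hW]; linarith) (by
      rw [hV, hW]; push_cast; linarith) F (by
      intro E hE p hp
      rcases Finset.mem_union.1 hE with hE | hE
      · obtain ⟨q, -, rfl⟩ := Finset.mem_image.1 (Finset.mem_filter.1 hE).1
        simp only [hev, walks, Finset.mem_filter] at hp
        exact hp.2.2.1
      · obtain ⟨u, -, rfl⟩ := Finset.mem_image.1 hE
        exact (Finset.mem_filter.1 hp).2.2) (by
      intro E hE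
      rcases Finset.mem_union.1 hE with hE | hE
      · refine le_trans ?_ (Finset.mem_filter.1 hE).2
        have : θ ≤ θ₀ := hθθ.trans (mul_le_of_le_one_right hθ₀.le hη1)
        gcongr
      · obtain ⟨u, -, rfl⟩ := Finset.mem_image.1 hE
        refine le_trans ?_ (hevZcard u)
        rw [hV]
        gcongr)
  have hhits' : ∀ E ∈ F, ⌊κ * n⌋₊ ≤ hits J E := by
    intro E hE
    refine Nat.floor_le_of_le ?_
    have h1 := hhits E hE
    have h2 : θ * (ε * n) ≤ θ * (m + 1) := by gcongr
    have h3 : θ * (ε * n) = 8 * (κ * n) := by rw [hκ]; ring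
    linarith
  obtain ⟨M, hM, hMc⟩ := hJ.exists_tiling hT (d := ⌊κ * n⌋₊) hcls (fun u => (hZ u).2)
    (fun z l hl v hv => hhits' _ (Finset.mem_union_left _ (Finset.mem_filter.2
      ⟨Finset.mem_image.2 ⟨(z, l, v), by simp [hl], rfl⟩, hv⟩)))
    (fun u => hhits' _ (Finset.mem_union_right _ (Finset.mem_image_of_mem _ (Finset.mem_univ u))))
    (by
      rw [hW, Nat.lt_iff_add_one_le]
      refine Nat.le_floor ?_
      push_cast
      have : ((L : ℝ) + 2) * (k * G.indepNum) ≤ (L + 2) * (k * (α * n)) := by gcongr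
      linarith)
  exact ⟨M, hM, hMc⟩

theorem indepNum_le_cliqueFreeNum_two {V : Type*} [Finite V] (G : SimpleGraph V) :
    G.indepNum ≤ G.cliqueFreeNum 2 := by
  have := Fintype.ofFinite V
  obtain ⟨s, hs⟩ := G.exists_isNIndepSet_indepNum
  refine le_csSup ⟨Fintype.card V, ?_⟩ ⟨s, hs.card_eq, ?_⟩
  · rintro m ⟨t, rfl, -⟩
    exact Finset.card_le_univ t
  · intro t hts ht
    obtain ⟨a, b, hab, rfl⟩ := Finset.card_eq_two.1 ht.card_eq
    have hadj : G.Adj a b := ht.isClique (by simp) (by simp) hab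
    exact hs.isIndepSet (hts (by simp)) (hts (by simp)) hab hadj

end Assembly

theorem mul_le_card_nbr_of_le_minDegree {V : Type*} [Fintype V] {G : SimpleGraph V}
    [DecidableRel G.Adj] {a : ℝ} (h : a ≤ G.minDegree) (v : V) : a ≤ (G.nbr v).card := by
  refine h.trans ?_
  have : G.neighborFinset v = G.nbr v := by ext; simp
  rw [← this, card_neighborFinset_eq_degree]
  exact_mod_cast G.minDegree_le_degree v

end SimpleGraph

theorem theorem1p7 (k : ℕ) (hk : 3 ≤ k) :
    (∀ η : ℝ, 0 < η → η ≤ 1 → ∃ α : ℝ, 0 < α ∧ ∀ᶠ n : ℕ in Filter.atTop,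
      ∀ (V : Type*) [Fintype V] (G : SimpleGraph V) [DecidableRel G.Adj],
        Fintype.card V = n → η * n ≤ G.minDegree → (G.indepNum : ℝ) ≤ α * n →
        ∀ (W : Type*) [Fintype W] (T : SimpleGraph W), Fintype.card W = k → T.IsTree →
          ∃ M : Set (SimpleGraph.Copy T G), T.IsQuasiperfectTiling G η M) ∧
    (∀ (W : Type*) [Fintype W] (T : SimpleGraph W), Fintype.card W = k → T.IsTree →
      SimpleGraph.RTT 2 T = 0) := by
  constructor
  · intro η hη hη1
    obtain ⟨α, hα, h⟩ := SimpleGraph.exists_quasiperfect_tiling hk hη hη1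
    refine ⟨α, hα, h.mono fun n hn V _ G _ hV hδ => hn V G hV fun v => ?_⟩
    exact SimpleGraph.mul_le_card_nbr_of_le_minDegree hδ v
  · intro W _ T hW hT
    classical
    have hmem := (SimpleGraph.isGreatest_RTT 2 T).1
    refine le_antisymm ?_ hmem.1
    by_contra! hpos
    -- Below the threshold, which is attained, yet at most `1`, so that the tiling result
    -- contradicts the extremal graphs.
    set η := min (SimpleGraph.RTT 2 T / 2) 1 with hη
    have hη0 : 0 < η := lt_min (by linarith) one_pos
    have hηlt : η < SimpleGraph.RTT 2 T := (min_le_left _ _).trans_lt (by linarith)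
    obtain ⟨α, hα, h⟩ := SimpleGraph.exists_quasiperfect_tiling hk hη0 (min_le_right _ _)
    obtain ⟨n, hn, G, hδ, hcf, hno⟩ := (h.and (hmem.2 η hη0 hηlt α hα)).exists
    refine hno (hn (Fin n) G (Fintype.card_fin n)
      (fun v => SimpleGraph.mul_le_card_nbr_of_le_minDegree hδ v) (le_trans ?_ hcf) W T hW hT)
    exact_mod_cast G.indepNum_le_cliqueFreeNum_two
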